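/- For $n\in\mathbb N=\{1,2,\dots\}$ let $\Phi_n$ be the class of real-valued continuous functions $f$ on $\mathbb R_+=[0,\infty)$ that are radial positive definite on $\mathbb R^n$, i.e. such that $$\sum_{k,j=1}^m f(|x_k-x_j|)\,\xi_j\overline{\xi_k}\ \ge\ 0$$ for all finite families of points $x_1,\dots,x_m\in\mathbb R^n$ and all $\xi_1,\dots,\xi_m\in\mathbb C$, where $|\cdot|$ is the Euclidean norm. Let $\Omega_n$ be the Schoenberg kernel $$\Omega_n(s)=\Gamma(q+1)\Bigl(\frac2s\Bigr)^q J_q(s)=\sum_{j=0}^\infty\frac{\Gamma(q+1)}{j!\,\Gamma(j+q+1)}\Bigl(-\frac{s^2}{4}\Bigr)^j,\qquad q=\frac n2-1,$$ where $J_q$ is the Bessel function of the first kind of order $q$ (the value at $s=0$ being that of the series). Then for every $n\in\mathbb N$: (i) for all real $a,b\ge 0$ with $a\ne b$, the function $t\mapsto\Omega_n(at)\,\Omega_n(bt)$, $t\ge0$, belongs to $\Phi_n\setminus\Phi_{n+1}$; (ii) the function $t\mapsto\Omega_n(t)^2$, $t\ge0$, belongs to $\Phi_{2n-1}\setminus\Phi_{2n}$.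 -/

import Mathlib

open scoped NNReal ComplexOrder ComplexConjugate

noncomputable section

/-- A real-valued continuous function `f` on `ℝ₊ = [0, ∞)` is a radial positive definite function
on `ℝⁿ` if `∑_{k,j} f(|x_k - x_j|) ξ_j conj(ξ_k) ≥ 0` for all finitely many points `x_k` of `ℝⁿ`
and complex numbers `ξ_k`.  (The order on `ℂ` is the usual partial one: `0 ≤ z` says that
`z` is real and nonnegative.) -/
def IsRadialPosDef (n : ℕ) (f : ℝ≥0 → ℝ) : Prop :=
  Continuous f ∧
    ∀ (m : ℕ) (x : Fin m → EuclideanSpace ℝ (Fin n)) (ξ : Fin m → ℂ),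
      0 ≤ ∑ k, ∑ j, (f ‖x k - x j‖₊ : ℂ) * ξ j * conj (ξ k)

/-- The class `Φ_n` of radial positive definite functions on `ℝⁿ`. -/
def radialPosDefClass (n : ℕ) : Set (ℝ≥0 → ℝ) :=
  {f | IsRadialPosDef n f}

/-- The Bessel function of the first kind of real order `q`, at a positive real argument. -/
def besselJ (q s : ℝ) : ℝ :=
  ∑' j : ℕ, (-1) ^ j / (j.factorial * Real.Gamma (j + q + 1)) * (s / 2) ^ (2 * (j : ℝ) + q)

/-- The Schoenberg kernel `Ω_n`, given by its everywhere convergent power series;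
with `q = n / 2 - 1` it is `Γ(q + 1) (2 / s) ^ q J_q(s)` for `s > 0`. -/
def schoenbergKernel (n : ℕ) (s : ℝ) : ℝ :=
  ∑' j : ℕ, Real.Gamma ((n : ℝ) / 2 - 1 + 1) /
    (j.factorial * Real.Gamma (j + ((n : ℝ) / 2 - 1) + 1)) * (-(s ^ 2 / 4)) ^ j

theorem schoenbergKernel_eq_besselJ (n : ℕ) {s : ℝ} (hs : 0 < s) :
    schoenbergKernel n s =
      Real.Gamma ((n : ℝ) / 2 - 1 + 1) * (2 / s) ^ ((n : ℝ) / 2 - 1) *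
        besselJ ((n : ℝ) / 2 - 1) s := by
  unfold schoenbergKernel besselJ
  rw [← tsum_mul_left]
  refine tsum_congr fun j => ?_
  have h2 : (0 : ℝ) < s / 2 := by positivity
  have h3 : (2 / s : ℝ) = (s / 2)⁻¹ := by rw [inv_div]
  have h4 : (s / 2) ^ (2 * (j : ℝ)) = (s ^ 2 / 4) ^ j := by
    rw [Real.rpow_mul h2.le, Real.rpow_natCast]
    congr 1
    norm_num
    ring
  rw [h3, Real.inv_rpow h2.le, Real.rpow_add h2, h4, neg_pow]
  have h5 : (s / 2) ^ ((n : ℝ) / 2 - 1) ≠ 0 := (Real.rpow_pos_of_pos h2 _).ne'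
  field_simp

end

/-!
`Ω_n(|x|)` is the Fourier transform of the uniform measure on the unit sphere of `ℝⁿ`, so
`Ω_n(at) Ω_n(bt)` is that of the law `μ` of `a • U + b • V` with `U`, `V` independent and uniform on
the sphere, hence is in `Φ_n`. For `a ≠ b` this law avoids a ball around `0`. The mean of
`Ω_n(at) Ω_n(bt)` over a Gaussian vector of variance `s` in `ℝⁿ⁺¹` must be nonnegative if the
function is in `Φ_{n+1}`; but it is the `μ`-mean of the Gaussian means of `t ↦ Ω_n(|y|t)`, which by
Kummer's transformation are negative as soon as `|y|² s` is large.

The power series coefficients of `Ω_n²` are `P(k)⁻¹` times those of `Ω_{2n-1}(2t)`, where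
`P(k) = ∏_{i<k} m_i` and each `m_i - 1` is the `2i`-th moment of a positive density on `[0, 1]`.
Multiplying coefficients by the `m_{k+N}` thus amounts to adding a mixture of dilations, which
preserves `Φ_{2n-1}`. Starting from `Ω_{2n-1}(2t)` this changes `P(k)` successively into `P(k + N)`,
and `P(k + N) → P(∞)`, so that `Ω_n²` is in `Φ_{2n-1}` as a limit.

The Gaussian means of a function in `Φ_d`, as a function of the variance, are positive definite on
the additive semigroup `[0, ∞)`. Differentiating this twice at a time gives
`G⁽²ᵐ⁺¹⁾(0)² ≤ G⁽²ᵐ⁾(0) G⁽²ᵐ⁺²⁾(0)`, which fails for `Ω_n²`, `d = 2n` and `m = n`.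
-/

open scoped Topology Nat
open Finset Filter MeasureTheory ProbabilityTheory RealInnerProductSpace Metric

noncomputable section

/-! ### Rising factorials and the coefficients of `Ω_n` and `Ω_n ^ 2` -/

local notation:max x:max "⁽" k "⁾" => Polynomial.eval x (ascPochhammer ℝ k)

lemma pochhammer_add (x : ℝ) (i j : ℕ) : x⁽i + j⁾ = x⁽i⁾ * (x + i)⁽j⁾ := by
  simp [← ascPochhammer_mul]

lemma pochhammer_le_pow_mul_pochhammer {x y : ℝ} (hx : 0 ≤ x) (hy : 0 < y) (k : ℕ) :
    x⁽k⁾ ≤ max 1 (x / y) ^ k * y⁽k⁾ := by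
  induction k with
  | zero => simp
  | succ k ih =>
    have factor : x + k ≤ max 1 (x / y) * (y + k) := by
      have hxy : x ≤ max 1 (x / y) * y := (div_le_iff₀ hy).1 (le_max_right _ _)
      have hk : (k : ℝ) ≤ max 1 (x / y) * k :=
        le_mul_of_one_le_left k.cast_nonneg (le_max_left _ _)
      linarith
    have hpos := (ascPochhammer_pos k y hy).le
    calc x⁽k + 1⁾ = x⁽k⁾ * (x + k) := ascPochhammer_succ_eval k x
      _ ≤ max 1 (x / y) ^ k * y⁽k⁾ * (max 1 (x / y) * (y + k)) := by gcongr
      _ = max 1 (x / y) ^ (k + 1) * y⁽k + 1⁾ := by rw [ascPochhammer_succ_eval]; ring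

lemma choose_add_sub_one_eq_pochhammer_div (x : ℝ) (k : ℕ) :
    Ring.choose (x + k - 1) k = x⁽k⁾ / k ! := by
  rw [← Ring.multichoose_eq, eq_div_iff (by positivity), mul_comm, ← nsmul_eq_mul,
    Ring.factorial_nsmul_multichoose_eq_ascPochhammer, Polynomial.ascPochhammer_smeval_eq_eval]

lemma choose_div_pochhammer_of_add_eq {ν : ℝ} (hν : 0 < ν) {i j k : ℕ} (hk : i + j = k) :
    Ring.choose (ν + k - 1) j / ν⁽k⁾ = 1 / (j ! * ν⁽i⁾) := by
  have hpos := ascPochhammer_pos i ν hν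
  have hpos' := ascPochhammer_pos j (ν + i) (by positivity)
  rw [← hk, pochhammer_add, Nat.cast_add, ← add_assoc, choose_add_sub_one_eq_pochhammer_div]
  field_simp

/-- The coefficients of the normalised Bessel function
`Γ(ν) (2 / t) ^ (ν - 1) J_(ν - 1)(t) = ∑ₖ besselCoeff ν k * (-t² / 4) ^ k`. -/
def besselCoeff (ν : ℝ) (k : ℕ) : ℝ := 1 / (k ! * ν⁽k⁾)

/-- The coefficients of the square of the power series with coefficients `besselCoeff ν`. -/
def besselSqCoeff (ν : ℝ) (k : ℕ) : ℝ := Ring.choose (2 * (ν + k - 1)) k / ν⁽k⁾ ^ 2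

lemma besselCoeff_pos {ν : ℝ} (hν : 0 < ν) (k : ℕ) : 0 < besselCoeff ν k := by
  have := ascPochhammer_pos k ν hν
  unfold besselCoeff
  positivity

lemma besselCoeff_succ {ν : ℝ} (hν : 0 < ν) (k : ℕ) :
    (k + 1) * (ν + k) * besselCoeff ν (k + 1) = besselCoeff ν k := by
  have := ascPochhammer_pos k ν hν
  rw [besselCoeff, besselCoeff, ascPochhammer_succ_eval, Nat.factorial_succ]
  push_cast
  field_simp

lemma sum_antidiagonal_besselCoeff_mul {ν : ℝ} (hν : 0 < ν) (k : ℕ) :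
    ∑ p ∈ antidiagonal k, besselCoeff ν p.1 * besselCoeff ν p.2 = besselSqCoeff ν k := by
  rw [besselSqCoeff, two_mul, Ring.add_choose_eq _ (Commute.all _ _), sum_div]
  refine sum_congr rfl fun p hp => ?_
  rw [HasAntidiagonal.mem_antidiagonal] at hp
  rw [pow_two, mul_div_mul_comm, choose_div_pochhammer_of_add_eq hν hp,
    choose_div_pochhammer_of_add_eq hν ((add_comm _ _).trans hp), besselCoeff, besselCoeff]
  ring

lemma besselSqCoeff_pos {ν : ℝ} (hν : 0 < ν) (k : ℕ) : 0 < besselSqCoeff ν k := by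
  rw [← sum_antidiagonal_besselCoeff_mul hν]
  exact sum_pos (fun p _ => mul_pos (besselCoeff_pos hν _) (besselCoeff_pos hν _))
    ⟨(0, k), by simp⟩

lemma succ_mul_choose_succ (r : ℝ) (k : ℕ) :
    (k + 1) * Ring.choose r (k + 1) = (r - k) * Ring.choose r k := by
  simpa [mul_comm] using Ring.choose_smul_choose r k.le_succ

lemma succ_mul_choose_succ_succ (r : ℝ) (k : ℕ) :
    (k + 1) * Ring.choose (r + 1) (k + 1) = (r + 1) * Ring.choose r k := by
  simpa using Ring.choose_smul_choose (r + 1) (Nat.le_add_left 1 k)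

lemma besselSqCoeff_succ {ν : ℝ} (hν : 0 < ν) (k : ℕ) :
    (k + 1) * (ν + k) * (2 * ν + k - 1) * besselSqCoeff ν (k + 1) =
      2 * (2 * ν + 2 * k - 1) * besselSqCoeff ν k := by
  have hpos := ascPochhammer_pos k ν hν
  set r : ℝ := 2 * (ν + k - 1) with hr
  have absorb_top := succ_mul_choose_succ_succ (r + 1) k
  have raise_index := succ_mul_choose_succ (r + 1) k
  have absorb := succ_mul_choose_succ_succ r k
  have choose_succ : (k + 1) * (r + 1 - k) * Ring.choose (r + 2) (k + 1) =
      (r + 2) * (r + 1) * Ring.choose r k := by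
    rw [show r + 1 + 1 = r + 2 by ring] at absorb_top
    linear_combination (r + 1 - k) * absorb_top - (r + 2) * raise_index + (r + 2) * absorb
  have hr' : 2 * (ν + (k + 1 : ℕ) - 1) = r + 2 := by push_cast; ring
  rw [besselSqCoeff, besselSqCoeff, hr', ← hr, ascPochhammer_succ_eval]
  field_simp
  rw [hr] at choose_succ ⊢
  linear_combination choose_succ

/-- Chu–Vandermonde in the form in which it gives Kummer's transformation. -/
lemma sum_antidiagonal_choose_div_pochhammer {ν : ℝ} (hν : 0 < ν) (a : ℝ) (k : ℕ) :
    ∑ p ∈ antidiagonal k, Ring.choose a p.1 / ν⁽p.1⁾ * (1 / p.2 !) =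
      (ν + a)⁽k⁾ * besselCoeff ν k := by
  have vandermonde := Ring.add_choose_eq k (Commute.all a (ν + k - 1))
  rw [show a + (ν + k - 1) = ν + a + k - 1 by ring, choose_add_sub_one_eq_pochhammer_div]
    at vandermonde
  rw [besselCoeff, ← div_eq_mul_one_div, ← div_div, vandermonde, sum_div]
  refine sum_congr rfl fun p hp => ?_
  rw [mul_div_assoc, choose_div_pochhammer_of_add_eq hν (HasAntidiagonal.mem_antidiagonal.1 hp)]
  ring

lemma abs_choose_le (a : ℝ) (k : ℕ) : |Ring.choose a k| ≤ |a|⁽k⁾ / k ! := by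
  induction k with
  | zero => simp
  | succ k ih =>
    have factor : |a - k| ≤ |a| + k := (abs_sub a k).trans_eq (by simp)
    rw [← mul_le_mul_iff_right₀ (by positivity : (0 : ℝ) < k + 1),
      ← abs_of_pos (by positivity : (0 : ℝ) < k + 1), ← abs_mul, succ_mul_choose_succ, abs_mul,
      abs_of_pos (by positivity : (0 : ℝ) < k + 1), ascPochhammer_succ_eval, Nat.factorial_succ]
    calc |a - k| * |Ring.choose a k| ≤ (|a| + k) * (|a|⁽k⁾ / k !) := by gcongr
      _ = (k + 1) * (|a|⁽k⁾ * (|a| + k) / ((k + 1) * k ! : ℕ)) := by push_cast; field_simp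

lemma neg_one_pow_mul_choose_succ_nonpos {a : ℝ} (ha₀ : 0 ≤ a) (ha₁ : a ≤ 1) (k : ℕ) :
    (-1) ^ (k + 1) * Ring.choose a (k + 1) ≤ 0 := by
  induction k with
  | zero => simpa using ha₀
  | succ k ih =>
    have raise_index := succ_mul_choose_succ a (k + 1)
    push_cast at raise_index
    refine nonpos_of_mul_nonpos_right (a := (k : ℝ) + 2) ?_ (by positivity)
    calc (k + 2 : ℝ) * ((-1) ^ (k + 1 + 1) * Ring.choose a (k + 1 + 1))
        = (k + 1 - a) * ((-1) ^ (k + 1) * Ring.choose a (k + 1)) := by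
          linear_combination (-1) ^ (k + 2) * raise_index
      _ ≤ 0 := mul_nonpos_of_nonneg_of_nonpos (by linarith [k.cast_nonneg (α := ℝ)]) ih

lemma summable_abs_choose_div_pochhammer_mul_pow (a : ℝ) {ν : ℝ} (hν : 0 < ν) (z : ℝ) :
    Summable fun k => |Ring.choose a k / ν⁽k⁾ * z ^ k| := by
  refine (Real.summable_pow_div_factorial (max 1 (|a| / ν) * |z|)).of_nonneg_of_le
    (fun k => abs_nonneg _) fun k => ?_
  have hpos := ascPochhammer_pos k ν hν
  rw [abs_mul, abs_div, abs_pow, abs_of_pos hpos, mul_pow, mul_div_right_comm]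
  refine mul_le_mul_of_nonneg_right ?_ (by positivity)
  rw [div_le_div_iff₀ hpos (by positivity), ← le_div_iff₀ (by positivity)]
  calc |Ring.choose a k| ≤ |a|⁽k⁾ / k ! := abs_choose_le a k
    _ ≤ max 1 (|a| / ν) ^ k * ν⁽k⁾ / k ! := by
      gcongr
      exact pochhammer_le_pow_mul_pochhammer (abs_nonneg a) hν k

/-- Kummer's transformation `M(ν + a; ν; z) = e ^ z M(-a; ν; -z)`. -/
lemma hasSum_kummer {ν : ℝ} (hν : 0 < ν) (a z : ℝ) :
    HasSum (fun k => (ν + a)⁽k⁾ * besselCoeff ν k * z ^ k)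
      (Real.exp z * ∑' k, Ring.choose a k / ν⁽k⁾ * z ^ k) := by
  have hchoose : Summable fun k => ‖Ring.choose a k / ν⁽k⁾ * z ^ k‖ :=
    summable_abs_choose_div_pochhammer_mul_pow a hν z
  have hexp : Summable fun k : ℕ => ‖z ^ k / (k ! : ℝ)‖ := (Real.summable_pow_div_factorial z).norm
  have product := tsum_mul_tsum_eq_tsum_sum_antidiagonal_of_summable_norm hchoose hexp
  rw [Real.exp_eq_exp_ℝ, NormedSpace.exp_eq_tsum_div, mul_comm, product]
  have coeff (k : ℕ) : ∑ p ∈ antidiagonal k,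
      Ring.choose a p.1 / ν⁽p.1⁾ * z ^ p.1 * (z ^ p.2 / p.2 !) =
        (ν + a)⁽k⁾ * besselCoeff ν k * z ^ k := by
    rw [← sum_antidiagonal_choose_div_pochhammer hν, sum_mul]
    refine sum_congr rfl fun p hp => ?_
    rw [← HasAntidiagonal.mem_antidiagonal.1 hp, pow_add]
    ring
  have summable := (summable_norm_sum_mul_antidiagonal_of_summable_norm hchoose hexp).of_norm
  simp only [coeff] at summable ⊢
  exact summable.hasSum

lemma Gamma_nat_add {x : ℝ} (hx : 0 < x) (k : ℕ) : Real.Gamma (k + x) = x⁽k⁾ * Real.Gamma x := by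
  induction k with
  | zero => simp
  | succ k ih =>
    rw [Nat.cast_succ, add_right_comm, Real.Gamma_add_one (by positivity), ih,
      ascPochhammer_succ_eval]
    ring

/-! ### Even entire functions of order less than two -/

/-- `f t = ∑ₖ e k * (-t² / 4) ^ k`, where the coefficients decay fast enough for the series to be
integrated termwise against Gaussian measures. -/
structure HasGaussianSeries (e : ℕ → ℝ) (f : ℝ≥0 → ℝ) : Prop where
  summable (R : ℝ) : Summable fun k => k ! * |e k| * R ^ k
  hasSum (t : ℝ≥0) : HasSum (fun k => e k * (-(t ^ 2 / 4 : ℝ)) ^ k) (f t)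

lemma factorial_le_two_pow_mul (i j : ℕ) : ((i + j)! : ℝ) ≤ 2 ^ (i + j) * (i ! * j !) := by
  rw [← Nat.add_choose_mul_factorial_mul_factorial]
  push_cast
  rw [mul_assoc]
  gcongr
  exact_mod_cast Nat.choose_le_two_pow _ _

lemma summable_norm_mul_pow {e : ℕ → ℝ} (h : ∀ R : ℝ, Summable fun k => k ! * |e k| * R ^ k)
    (R : ℝ) : Summable fun k => ‖e k * R ^ k‖ := by
  refine (h |R|).of_nonneg_of_le (fun k => norm_nonneg _) fun k => ?_
  rw [norm_mul, norm_pow, Real.norm_eq_abs, Real.norm_eq_abs]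
  gcongr
  exact le_mul_of_one_le_left (abs_nonneg _) (by exact_mod_cast k.factorial_pos)

namespace HasGaussianSeries

variable {e e' : ℕ → ℝ} {f f' : ℝ≥0 → ℝ}

lemma summable_pochhammer (h : HasGaussianSeries e f) {x : ℝ} (hx : 0 < x) (R : ℝ) :
    Summable fun k => |e k * x⁽k⁾ * R ^ k| := by
  refine (h.summable (max 1 x * |R|)).of_nonneg_of_le (fun k => abs_nonneg _) fun k => ?_
  have hxk : x⁽k⁾ ≤ max 1 x ^ k * k ! := by
    simpa using pochhammer_le_pow_mul_pochhammer hx.le one_pos k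
  have hpos := ascPochhammer_pos k x hx
  calc |e k * x⁽k⁾ * R ^ k| = |e k| * x⁽k⁾ * |R| ^ k := by
        rw [abs_mul, abs_mul, abs_pow, abs_of_pos hpos]
    _ ≤ |e k| * (max 1 x ^ k * k !) * |R| ^ k := by gcongr
    _ = k ! * |e k| * (max 1 x * |R|) ^ k := by rw [mul_pow]; ring

lemma summable_norm (h : HasGaussianSeries e f) (R : ℝ) : Summable fun k => ‖e k * R ^ k‖ :=
  summable_norm_mul_pow h.summable R

protected lemma mul (h : HasGaussianSeries e f) (h' : HasGaussianSeries e' f') :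
    HasGaussianSeries (fun k => ∑ p ∈ antidiagonal k, e p.1 * e' p.2) fun t => f t * f' t where
  summable R := by
    refine .of_norm_bounded (summable_norm_sum_mul_antidiagonal_of_summable_norm
      (h.summable (2 * |R|)).norm (h'.summable (2 * |R|)).norm).of_norm fun k => ?_
    rw [norm_mul, norm_mul, norm_pow, Real.norm_eq_abs, Real.norm_eq_abs, Real.norm_eq_abs,
      abs_abs, Nat.abs_cast]
    calc (k ! : ℝ) * |∑ p ∈ antidiagonal k, e p.1 * e' p.2| * |R| ^ k
        ≤ k ! * (∑ p ∈ antidiagonal k, |e p.1| * |e' p.2|) * |R| ^ k := by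
          gcongr
          exact (abs_sum_le_sum_abs _ _).trans_eq (sum_congr rfl fun p _ => abs_mul _ _)
      _ = ∑ p ∈ antidiagonal k, k ! * (|e p.1| * |e' p.2|) * |R| ^ k := by
          rw [mul_sum, sum_mul]
      _ ≤ _ := sum_le_sum fun p hp => by
          rw [← HasAntidiagonal.mem_antidiagonal.1 hp]
          calc ((p.1 + p.2)! : ℝ) * (|e p.1| * |e' p.2|) * |R| ^ (p.1 + p.2)
              ≤ 2 ^ (p.1 + p.2) * (p.1 ! * p.2 !) * (|e p.1| * |e' p.2|) * |R| ^ (p.1 + p.2) := by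
                gcongr
                exact factorial_le_two_pow_mul _ _
            _ = _ := by rw [mul_pow, mul_pow, pow_add, pow_add]; ring
  hasSum t := by
    set z : ℝ := -(t ^ 2 / 4)
    have product := tsum_mul_tsum_eq_tsum_sum_antidiagonal_of_summable_norm
      (h.summable_norm z) (h'.summable_norm z)
    have summable := (summable_norm_sum_mul_antidiagonal_of_summable_norm
      (h.summable_norm z) (h'.summable_norm z)).of_norm
    have coeff (k : ℕ) : ∑ p ∈ antidiagonal k, e p.1 * z ^ p.1 * (e' p.2 * z ^ p.2) =
        (∑ p ∈ antidiagonal k, e p.1 * e' p.2) * z ^ k := by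
      rw [sum_mul]
      refine sum_congr rfl fun p hp => ?_
      rw [← HasAntidiagonal.mem_antidiagonal.1 hp, pow_add]
      ring
    simp only [coeff] at product summable
    rw [← (h.hasSum t).tsum_eq, ← (h'.hasSum t).tsum_eq, product]
    exact summable.hasSum

end HasGaussianSeries

lemma summable_factorial_mul_besselCoeff {ν : ℝ} (hν : 0 < ν) (R : ℝ) :
    Summable fun k => k ! * |besselCoeff ν k| * R ^ k := by
  refine .of_norm_bounded (Real.summable_pow_div_factorial (max 1 (1 / ν) * |R|)) fun k => ?_
  have hpos := ascPochhammer_pos k ν hν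
  have hfac : (k ! : ℝ) ≤ max 1 (1 / ν) ^ k * ν⁽k⁾ := by
    simpa only [ascPochhammer_eval_one] using
      pochhammer_le_pow_mul_pochhammer zero_le_one hν k
  calc ‖k ! * |besselCoeff ν k| * R ^ k‖ = 1 / ν⁽k⁾ * |R| ^ k := by
        rw [norm_mul, norm_mul, norm_pow, Real.norm_natCast, Real.norm_eq_abs, Real.norm_eq_abs,
          abs_abs, abs_of_pos (besselCoeff_pos hν k), besselCoeff]
        field_simp
    _ ≤ max 1 (1 / ν) ^ k / k ! * |R| ^ k := by
        refine mul_le_mul_of_nonneg_right ?_ (by positivity)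
        rwa [div_le_div_iff₀ hpos (by positivity), one_mul]
    _ = (max 1 (1 / ν) * |R|) ^ k / k ! := by rw [mul_pow, mul_div_right_comm]

lemma hasGaussianSeries_schoenbergKernel {n : ℕ} (hn : 1 ≤ n) :
    HasGaussianSeries (besselCoeff (n / 2)) fun t => schoenbergKernel n t := by
  have hν : (0 : ℝ) < n / 2 := by positivity
  have coeff (t : ℝ≥0) (k : ℕ) : Real.Gamma ((n : ℝ) / 2 - 1 + 1) /
      (k ! * Real.Gamma (k + ((n : ℝ) / 2 - 1) + 1)) * (-(t ^ 2 / 4)) ^ k =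
        besselCoeff (n / 2) k * (-(t ^ 2 / 4)) ^ k := by
    have hΓ := (Real.Gamma_pos_of_pos hν).ne'
    rw [sub_add_cancel, add_assoc, sub_add_cancel, Gamma_nat_add hν, besselCoeff]
    field_simp
  refine ⟨summable_factorial_mul_besselCoeff hν, fun t => ?_⟩
  simp only [schoenbergKernel, coeff]
  exact (summable_norm_mul_pow (summable_factorial_mul_besselCoeff hν) _).of_norm.hasSum

lemma hasGaussianSeries_schoenbergKernel_sq {n : ℕ} (hn : 1 ≤ n) :
    HasGaussianSeries (besselSqCoeff (n / 2)) fun t => schoenbergKernel n t ^ 2 := by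
  have hν : (0 : ℝ) < n / 2 := by positivity
  simpa only [sum_antidiagonal_besselCoeff_mul hν, ← sq] using
    (hasGaussianSeries_schoenbergKernel hn).mul (hasGaussianSeries_schoenbergKernel hn)

/-! ### Gaussian vectors and their directions -/

section Gaussian

/-- The density of the standard Gaussian measure of a `d`-dimensional Euclidean space, as a function
of the distance to the origin. -/
def gaussianProfile (d : ℕ) (r : ℝ) : ℝ :=
  ((2 * Real.pi) ^ (d / 2 : ℝ))⁻¹ * Real.exp (-(1 / 2) * r ^ 2)

lemma gaussianProfile_pos (d : ℕ) (r : ℝ) : 0 < gaussianProfile d r := by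
  unfold gaussianProfile
  positivity

@[fun_prop]
lemma continuous_gaussianProfile (d : ℕ) : Continuous (gaussianProfile d) := by
  unfold gaussianProfile
  fun_prop

variable {E : Type*} [NormedAddCommGroup E] [InnerProductSpace ℝ E] [FiniteDimensional ℝ E]
  [MeasurableSpace E] [BorelSpace E]

local notation "dim" => Module.finrank ℝ E

lemma integrable_gaussianProfile_norm : Integrable fun x : E => gaussianProfile dim ‖x‖ := by
  have h := (GaussianFourier.integrable_cexp_neg_mul_sq_norm_add (V := E) (b := 1 / 2)
    (by norm_num) 0 0).re
  refine (h.const_mul ((2 * Real.pi) ^ (dim / 2 : ℝ))⁻¹).congr (.of_forall fun x => ?_)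
  simp [gaussianProfile, ← Complex.ofReal_pow, ← Complex.exp_ofReal_re]

lemma stdGaussian_eq_withDensity :
    stdGaussian E = volume.withDensity fun x => ENNReal.ofReal (gaussianProfile dim ‖x‖) := by
  have : IsFiniteMeasure
      (volume.withDensity fun x : E => ENNReal.ofReal (gaussianProfile dim ‖x‖)) :=
    isFiniteMeasure_withDensity_ofReal integrable_gaussianProfile_norm.2
  refine Measure.ext_of_charFun (funext fun t => ?_)
  have density (x : E) : (ENNReal.ofReal (gaussianProfile dim ‖x‖)).toReal •
      Complex.exp (⟪x, t⟫ * Complex.I) = (((2 * Real.pi) ^ (dim / 2 : ℝ))⁻¹ : ℝ) *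
        Complex.exp (-(1 / 2) * ‖x‖ ^ 2 + Complex.I * ⟪t, x⟫) := by
    rw [ENNReal.toReal_ofReal (gaussianProfile_pos _ _).le, gaussianProfile, Complex.real_smul,
      Complex.exp_add, real_inner_comm, mul_comm Complex.I]
    push_cast
    ring
  have normalisation : (Real.pi / (1 / 2) : ℂ) ^ (dim / 2 : ℂ) =
      (((2 * Real.pi) ^ (dim / 2 : ℝ) : ℝ) : ℂ) := by
    rw [Complex.ofReal_cpow (by positivity)]
    push_cast
    ring_nf
  rw [charFun_stdGaussian, charFun_apply, integral_withDensity_eq_integral_toReal_smul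
    (by fun_prop) (by simp)]
  simp_rw [density]
  rw [integral_const_mul, GaussianFourier.integral_cexp_neg_mul_sq_norm_add (by norm_num),
    normalisation, ← mul_assoc, ← Complex.ofReal_mul, inv_mul_cancel₀ (by positivity),
    Complex.I_sq, Complex.ofReal_one, one_mul]
  ring_nf

lemma integral_stdGaussian (f : E → ℝ) :
    ∫ x, f x ∂stdGaussian E = ∫ x, f x * gaussianProfile dim ‖x‖ := by
  rw [stdGaussian_eq_withDensity, integral_withDensity_eq_integral_toReal_smul
    (by fun_prop) (by simp)]
  refine integral_congr_ae (.of_forall fun x => ?_)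
  beta_reduce
  rw [ENNReal.toReal_ofReal (gaussianProfile_pos _ _).le, smul_eq_mul, mul_comm]

lemma integral_Ioi_pow_mul_exp (q : ℕ) :
    ∫ y in Set.Ioi (0 : ℝ), y ^ q * Real.exp (-(1 / 2) * y ^ 2) =
      2 ^ ((q + 1 : ℝ) / 2) * (1 / 2) * Real.Gamma ((q + 1) / 2) := by
  have h := integral_rpow_mul_exp_neg_mul_rpow (p := 2) (q := q) (b := 1 / 2) (by norm_num)
    (by linarith [(q.cast_nonneg : (0 : ℝ) ≤ q)]) (by norm_num)
  rw [one_div, Real.inv_rpow zero_le_two, ← Real.rpow_neg zero_le_two, neg_div, neg_neg] at h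
  simpa using h

lemma exists_integral_norm_pow_stdGaussian_eq_mul_Gamma [Nontrivial E] :
    ∃ C : ℝ, ∀ k : ℕ, ∫ x, ‖x‖ ^ (2 * k) ∂stdGaussian E =
      C * (2 ^ k * Real.Gamma (k + dim / 2)) := by
  refine ⟨dim * (volume : Measure E).real (ball 0 1) * ((2 * Real.pi) ^ (dim / 2 : ℝ))⁻¹ *
    2 ^ (dim / 2 : ℝ) * (1 / 2), fun k => ?_⟩
  have hd : 0 < dim := Module.finrank_pos
  have integrand (y : ℝ) : y ^ (dim - 1) • (y ^ (2 * k) * gaussianProfile dim y) =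
      ((2 * Real.pi) ^ (dim / 2 : ℝ))⁻¹ *
        (y ^ (dim - 1 + 2 * k) * Real.exp (-(1 / 2) * y ^ 2)) := by
    rw [smul_eq_mul, pow_add, gaussianProfile]
    ring
  have exponent : ((dim - 1 + 2 * k : ℕ) + 1 : ℝ) / 2 = k + (dim : ℝ) / 2 := by
    push_cast [Nat.cast_sub hd]
    ring
  rw [integral_stdGaussian,
    integral_fun_norm_addHaar volume fun y => y ^ (2 * k) * gaussianProfile dim y]
  simp_rw [integrand]
  rw [integral_const_mul, integral_Ioi_pow_mul_exp, exponent, Real.rpow_add two_pos,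
    Real.rpow_natCast, nsmul_eq_mul, smul_eq_mul]
  ring

lemma integral_norm_pow_stdGaussian [Nontrivial E] (k : ℕ) :
    ∫ x, ‖x‖ ^ (2 * k) ∂stdGaussian E = 2 ^ k * (dim / 2 : ℝ)⁽k⁾ := by
  have hd : 0 < dim := Module.finrank_pos
  obtain ⟨C, hC⟩ := exists_integral_norm_pow_stdGaussian_eq_mul_Gamma (E := E)
  have total_mass : 1 = C * Real.Gamma (dim / 2) := by simpa using hC 0
  rw [hC, Gamma_nat_add (by positivity)]
  linear_combination -(2 ^ k * (dim / 2 : ℝ)⁽k⁾) * total_mass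

lemma map_inner_stdGaussian (x : E) :
    (stdGaussian E).map (fun y => ⟪x, y⟫) = (stdGaussian ℝ).map (fun t => ‖x‖ * t) := by
  have := Measure.isProbabilityMeasure_map (μ := stdGaussian E) (f := fun y => ⟪x, y⟫)
    (by fun_prop)
  have := Measure.isProbabilityMeasure_map (μ := stdGaussian ℝ) (f := fun t => ‖x‖ * t)
    (by fun_prop)
  refine Measure.ext_of_charFun (funext fun s => ?_)
  have inner_eq (y : E) : ⟪⟪x, y⟫, s⟫ = ⟪y, s • x⟫ := by
    rw [real_inner_smul_right, real_inner_comm x y, RCLike.inner_apply, conj_trivial, mul_comm]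
  rw [charFun_map_mul, charFun_stdGaussian, charFun_apply, integral_map (by fun_prop)
    (by fun_prop)]
  simp_rw [inner_eq, ← charFun_apply, charFun_stdGaussian, norm_smul, norm_mul, norm_norm,
    mul_comm]

lemma integral_inner_pow_stdGaussian (x : E) (k : ℕ) :
    ∫ y, ⟪x, y⟫ ^ (2 * k) ∂stdGaussian E = ‖x‖ ^ (2 * k) * (2 ^ k * (1 / 2 : ℝ)⁽k⁾) := by
  have one_dimensional : ∫ t, t ^ (2 * k) ∂stdGaussian ℝ = 2 ^ k * (1 / 2 : ℝ)⁽k⁾ := by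
    simpa [Even.pow_abs (even_two_mul k)] using integral_norm_pow_stdGaussian (E := ℝ) k
  calc ∫ y, ⟪x, y⟫ ^ (2 * k) ∂stdGaussian E
      = ∫ t, t ^ (2 * k) ∂(stdGaussian E).map fun y => ⟪x, y⟫ := by
        rw [integral_map (by fun_prop) (by fun_prop)]
    _ = ∫ t, ‖x‖ ^ (2 * k) * t ^ (2 * k) ∂stdGaussian ℝ := by
        rw [map_inner_stdGaussian, integral_map (by fun_prop) (by fun_prop)]
        simp_rw [mul_pow]
    _ = _ := by rw [integral_const_mul, one_dimensional]

variable (E) in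
/-- The uniform probability measure on the unit sphere of `E`, as a measure on `E`: the law of the
direction of a Gaussian vector. -/
def uniformSphere : Measure E := (stdGaussian E).map fun y => ‖y‖⁻¹ • y

instance : IsProbabilityMeasure (uniformSphere E) :=
  Measure.isProbabilityMeasure_map (by fun_prop)

lemma map_neg_uniformSphere : (uniformSphere E).map (fun u => -u) = uniformSphere E := by
  have symmetric : (stdGaussian E).map (fun y => -y) = stdGaussian E :=
    stdGaussian_map (LinearIsometryEquiv.neg ℝ)
  rw [uniformSphere, Measure.map_map (by fun_prop) (by fun_prop)]
  nth_rw 2 [← symmetric]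
  rw [Measure.map_map (by fun_prop) (by fun_prop)]
  simp [Function.comp_def]

lemma norm_eq_one_ae_uniformSphere [Nontrivial E] : ∀ᵐ u ∂uniformSphere E, ‖u‖ = 1 := by
  have nonzero : ∀ᵐ y ∂stdGaussian E, y ≠ 0 := by
    rw [stdGaussian_eq_withDensity]
    exact (withDensity_absolutelyContinuous _ _).ae_le (Measure.ae_ne _ 0)
  rw [uniformSphere, ae_map_iff (by fun_prop) (measurableSet_eq_fun (by fun_prop) (by fun_prop))]
  filter_upwards [nonzero] with y hy
  exact norm_smul_inv_norm hy

lemma integral_direction_mul_radial [Nontrivial E] (ψ : E → ℝ) (g : ℝ → ℝ) :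
    ∫ y, ψ (‖y‖⁻¹ • y) * g ‖y‖ = (∫ u : sphere (0 : E) 1, ψ u ∂(volume : Measure E).toSphere) *
      ∫ r : Set.Ioi (0 : ℝ), g r ∂.volumeIoiPow (dim - 1) :=
  calc ∫ y, ψ (‖y‖⁻¹ • y) * g ‖y‖
      = ∫ x : ({0}ᶜ : Set E), ψ (‖(x : E)‖⁻¹ • (x : E)) * g ‖(x : E)‖
          ∂((volume : Measure E).comap (↑)) := by
        rw [integral_subtype_comap (measurableSet_singleton _).compl
          fun x => ψ (‖x‖⁻¹ • x) * g ‖x‖, restrict_compl_singleton]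
    _ = ∫ p : sphere (0 : E) 1 × Set.Ioi (0 : ℝ), ψ p.1 * g p.2
          ∂(volume : Measure E).toSphere.prod (.volumeIoiPow (dim - 1)) := by
        rw [← (volume : Measure E).measurePreserving_homeomorphUnitSphereProd.integral_comp
          (Homeomorph.measurableEmbedding _)]
        simp only [homeomorphUnitSphereProd_apply_fst_coe, homeomorphUnitSphereProd_apply_snd_coe]
    _ = _ := integral_prod_mul (fun u : sphere (0 : E) 1 => ψ u) fun r : Set.Ioi (0 : ℝ) => g r

lemma integral_direction_mul_radial_stdGaussian [Nontrivial E] {ψ : E → ℝ} (hψ : Measurable ψ)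
    (g : ℝ → ℝ) : ∫ y, ψ (‖y‖⁻¹ • y) * g ‖y‖ ∂stdGaussian E =
      (∫ u, ψ u ∂uniformSphere E) * ∫ y, g ‖y‖ ∂stdGaussian E := by
  have polar (ψ : E → ℝ) (g : ℝ → ℝ) : ∫ y, ψ (‖y‖⁻¹ • y) * g ‖y‖ ∂stdGaussian E =
      (∫ u : sphere (0 : E) 1, ψ u ∂(volume : Measure E).toSphere) *
        ∫ r : Set.Ioi (0 : ℝ), g r * gaussianProfile dim r ∂.volumeIoiPow (dim - 1) := by
    rw [integral_stdGaussian]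
    simp_rw [mul_assoc]
    exact integral_direction_mul_radial ψ fun r => g r * gaussianProfile dim r
  have angular := polar ψ 1
  have radial := polar 1 g
  have total_mass := polar 1 1
  simp only [Pi.one_apply, one_mul, mul_one, integral_const, probReal_univ, smul_eq_mul]
    at angular radial total_mass
  rw [uniformSphere, integral_map (by fun_prop) hψ.aestronglyMeasurable, angular, radial, polar ψ g]
  linear_combination (∫ u : sphere (0 : E) 1, ψ u ∂(volume : Measure E).toSphere) *
    (∫ r : Set.Ioi (0 : ℝ), g r * gaussianProfile dim r ∂.volumeIoiPow (dim - 1)) * total_mass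

lemma integral_inner_pow_uniformSphere [Nontrivial E] (x : E) (k : ℕ) :
    ∫ u, ⟪x, u⟫ ^ (2 * k) ∂uniformSphere E =
      ‖x‖ ^ (2 * k) * ((1 / 2 : ℝ)⁽k⁾ / (dim / 2 : ℝ)⁽k⁾) := by
  have split := integral_direction_mul_radial_stdGaussian (E := E)
    (ψ := fun u => ⟪x, u⟫ ^ (2 * k)) (by fun_prop) fun r => r ^ (2 * k)
  have homogeneous (y : E) : ⟪x, ‖y‖⁻¹ • y⟫ ^ (2 * k) * ‖y‖ ^ (2 * k) = ⟪x, y⟫ ^ (2 * k) := by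
    rcases eq_or_ne y 0 with rfl | hy
    · simp [← mul_pow]
    · rw [← mul_pow, real_inner_smul_right, mul_right_comm, inv_mul_cancel₀ (norm_ne_zero_iff.2 hy),
        one_mul]
  have hpos := ascPochhammer_pos k (dim / 2 : ℝ)
    (by have : 0 < dim := Module.finrank_pos
        positivity)
  simp only [homogeneous, integral_inner_pow_stdGaussian, integral_norm_pow_stdGaussian] at split
  field_simp
  refine mul_left_cancel₀ (pow_ne_zero k two_ne_zero : (2 : ℝ) ^ k ≠ 0) ?_
  linear_combination -split

lemma factorial_two_mul (k : ℕ) : ((2 * k)! : ℝ) = 4 ^ k * k ! * (1 / 2 : ℝ)⁽k⁾ := by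
  induction k with
  | zero => simp
  | succ k ih =>
    rw [mul_add_one, Nat.factorial_succ, Nat.factorial_succ, Nat.factorial_succ,
      ascPochhammer_succ_eval]
    push_cast
    rw [ih]
    ring

lemma hasSum_integral_cos_inner_uniformSphere [Nontrivial E] (x : E) :
    HasSum (fun k => besselCoeff (dim / 2) k * (-(‖x‖ ^ 2 / 4)) ^ k)
      (∫ u, Real.cos ⟪x, u⟫ ∂uniformSphere E) := by
  have term_integral (k : ℕ) :
      ∫ u, (-1) ^ k * ⟪x, u⟫ ^ (2 * k) / (2 * k)! ∂uniformSphere E =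
        besselCoeff (dim / 2) k * (-(‖x‖ ^ 2 / 4)) ^ k := by
    have hd : 0 < dim := Module.finrank_pos
    have hpos := ascPochhammer_pos k (dim / 2 : ℝ) (by positivity)
    have hpos' := ascPochhammer_pos k (1 / 2 : ℝ) (by positivity)
    rw [integral_div, integral_const_mul, integral_inner_pow_uniformSphere, besselCoeff,
      factorial_two_mul, neg_pow (‖x‖ ^ 2 / 4), div_pow, pow_mul]
    field_simp
  simp_rw [← term_integral]
  have bounded : ∀ᵐ u ∂uniformSphere E, |⟪x, u⟫| ≤ ‖x‖ := by
    filter_upwards [norm_eq_one_ae_uniformSphere] with u hu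
    simpa [hu] using abs_real_inner_le_norm x u
  refine hasSum_integral_of_dominated_convergence (fun k _ => ‖x‖ ^ (2 * k) / (2 * k)!)
    (fun k => by fun_prop) (fun k => ?_)
    (.of_forall fun _ => (Real.hasSum_cosh ‖x‖).summable)
    (integrable_const _) (.of_forall fun u => Real.hasSum_cos ⟪x, u⟫)
  filter_upwards [bounded] with u hu
  rw [norm_div, norm_mul, norm_pow, norm_pow, norm_neg, norm_one, one_pow, one_mul,
    Real.norm_natCast, Real.norm_eq_abs]
  gcongr

lemma charFun_uniformSphere [Nontrivial E] (x : E) :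
    charFun (uniformSphere E) x = schoenbergKernel dim ‖x‖ := by
  have hdim : 1 ≤ dim := Module.finrank_pos
  have symmetric : conj (charFun (uniformSphere E) x) = charFun (uniformSphere E) x := by
    rw [← charFun_neg]
    nth_rw 2 [← map_neg_uniformSphere]
    rw [charFun_apply, charFun_apply, integral_map (by fun_prop) (by fun_prop)]
    simp
  have real_part : (charFun (uniformSphere E) x).re =
      ∫ u, Real.cos ⟪x, u⟫ ∂uniformSphere E := by
    have bounded : Integrable (fun u => Complex.exp (⟪u, x⟫ * Complex.I)) (uniformSphere E) :=
      .of_bound (by fun_prop) 1 (.of_forall fun u => (Complex.norm_exp_ofReal_mul_I _).le)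
    rw [charFun_apply, ← RCLike.re_eq_complex_re, ← integral_re bounded]
    simp_rw [RCLike.re_eq_complex_re, Complex.exp_ofReal_mul_I_re, real_inner_comm x]
  rw [← Complex.conj_eq_iff_re.1 symmetric, real_part]
  exact congrArg _ ((hasSum_integral_cos_inner_uniformSphere x).unique
    ((hasGaussianSeries_schoenbergKernel hdim).hasSum ‖x‖₊))

end Gaussian

/-! ### Radial positive definite functions -/

lemma nontrivial_euclideanSpace_fin {n : ℕ} (hn : 1 ≤ n) :
    Nontrivial (EuclideanSpace ℝ (Fin n)) :=
  Module.nontrivial_of_finrank_pos (R := ℝ) (by rwa [finrank_euclideanSpace_fin])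

lemma isRadialPosDef_of_real {n : ℕ} {f : ℝ≥0 → ℝ} (hf : Continuous f)
    (h : ∀ (m : ℕ) (x : Fin m → EuclideanSpace ℝ (Fin n)) (c : Fin m → ℝ),
      0 ≤ ∑ k, ∑ j, f ‖x k - x j‖₊ * c j * c k) : IsRadialPosDef n f := by
  refine ⟨hf, fun m x ξ => Complex.nonneg_iff.2 ?_⟩
  have symmetric : ∑ k, ∑ j, f ‖x k - x j‖₊ * (ξ j).im * (ξ k).re =
      ∑ k, ∑ j, f ‖x k - x j‖₊ * (ξ j).re * (ξ k).im := by
    rw [sum_comm]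
    refine sum_congr rfl fun k _ => sum_congr rfl fun j _ => ?_
    rw [← nnnorm_neg, neg_sub, mul_right_comm]
  simp only [Complex.re_sum, Complex.im_sum, Complex.mul_re, Complex.mul_im, Complex.ofReal_re,
    Complex.ofReal_im, Complex.conj_re, Complex.conj_im, zero_mul, sub_zero, add_zero, mul_neg,
    sub_neg_eq_add, sum_add_distrib, sum_neg_distrib]
  refine ⟨add_nonneg (h m x fun k => (ξ k).re) (h m x fun k => (ξ k).im), ?_⟩
  linarith

lemma isRadialPosDef_of_charFun {n : ℕ} (hn : 1 ≤ n) {f : ℝ≥0 → ℝ}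
    {μ : Measure (EuclideanSpace ℝ (Fin n))} [IsFiniteMeasure μ]
    (h : ∀ x, charFun μ x = f ‖x‖₊) : IsRadialPosDef n f := by
  have continuous : Continuous f := by
    have := nontrivial_euclideanSpace_fin hn
    obtain ⟨w, hw⟩ := exists_norm_eq (EuclideanSpace ℝ (Fin n)) zero_le_one
    have along_ray (t : ℝ≥0) : f t = (charFun μ ((t : ℝ) • w)).re := by
      rw [h, nnnorm_smul, NNReal.nnnorm_eq, NNReal.eq (n := ‖w‖₊) (m := 1) hw, mul_one,
        Complex.ofReal_re]
    have := continuous_charFun (μ := μ)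
    exact (by fun_prop : Continuous fun t : ℝ≥0 => (charFun μ ((t : ℝ) • w)).re).congr
      fun t => (along_ray t).symm
  have bounded (x) : Integrable (fun y => Complex.exp (⟪y, x⟫ * Complex.I)) μ :=
    .of_bound (by fun_prop) 1 (.of_forall fun y => (Complex.norm_exp_ofReal_mul_I _).le)
  refine ⟨continuous, fun m x ξ => ?_⟩
  have square (y : EuclideanSpace ℝ (Fin n)) :
      ∑ k, ∑ j, Complex.exp (⟪y, x k - x j⟫ * Complex.I) * (ξ j * conj (ξ k)) =
        (Complex.normSq (∑ j, ξ j * Complex.exp (-(⟪y, x j⟫ * Complex.I))) : ℝ) := by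
    rw [← Complex.mul_conj, map_sum, sum_mul_sum, sum_comm]
    refine sum_congr rfl fun k _ => sum_congr rfl fun j _ => ?_
    rw [map_mul, ← Complex.exp_conj, inner_sub_right]
    simp only [map_neg, map_mul, Complex.conj_ofReal, Complex.conj_I, mul_neg, neg_neg]
    rw [Complex.ofReal_sub, sub_mul, sub_eq_add_neg, Complex.exp_add]
    ring
  have form : ∑ k, ∑ j, (f ‖x k - x j‖₊ : ℂ) * ξ j * conj (ξ k) =
      ∫ y, (Complex.normSq (∑ j, ξ j * Complex.exp (-(⟪y, x j⟫ * Complex.I))) : ℂ) ∂μ := by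
    simp_rw [← square, ← h, charFun_apply, mul_assoc, ← integral_mul_const]
    rw [integral_finsetSum _ fun k _ =>
      integrable_finsetSum _ fun j _ => (bounded _).mul_const _]
    simp_rw [integral_finsetSum univ fun j _ => (bounded (x _ - x j)).mul_const _]
  rw [form, integral_complex_ofReal]
  exact_mod_cast integral_nonneg fun y => Complex.normSq_nonneg _

lemma isRadialPosDef_of_tendsto {n : ℕ} {f : ℝ≥0 → ℝ} (hf : Continuous f) {g : ℕ → ℝ≥0 → ℝ}
    (hg : ∀ N, IsRadialPosDef n (g N)) (h : ∀ t, Tendsto (g · t) atTop (𝓝 (f t))) :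
    IsRadialPosDef n f := by
  refine ⟨hf, fun m x ξ => ge_of_tendsto' (x := atTop) ?_ fun N => (hg N).2 m x ξ⟩
  exact tendsto_finsetSum _ fun k _ => tendsto_finsetSum _ fun j _ =>
    (((Complex.continuous_ofReal.tendsto _).comp (h _)).mul_const _).mul_const _

namespace IsRadialPosDef

variable {n : ℕ} {f g : ℝ≥0 → ℝ}

lemma sum_nonneg (hf : IsRadialPosDef n f) {ι : Type*} [Fintype ι]
    (x : ι → EuclideanSpace ℝ (Fin n)) (c : ι → ℝ) :
    0 ≤ ∑ k, ∑ j, f ‖x k - x j‖₊ * c j * c k := by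
  let e := (Fintype.equivFin ι).symm
  have h := hf.2 _ (fun i => x (e i)) fun i => (c (e i) : ℂ)
  simp only [Complex.conj_ofReal] at h
  norm_cast at h
  rw [e.sum_comp fun k => ∑ j, f ‖x k - x (e j)‖₊ * c (e j) * c k] at h
  refine h.trans_eq (sum_congr rfl fun k _ => e.sum_comp fun j => f ‖x k - x j‖₊ * c j * c k)

lemma abs_apply_nnnorm_le (hf : IsRadialPosDef n f) (x : EuclideanSpace ℝ (Fin n)) :
    |f ‖x‖₊| ≤ f 0 := by
  have minus : 0 ≤ f 0 + -f ‖x‖₊ + (-f ‖x‖₊ + f 0) := by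
    simpa [Fin.sum_univ_two] using hf.sum_nonneg ![x, 0] ![1, -1]
  have plus : 0 ≤ f 0 + f ‖x‖₊ + (f ‖x‖₊ + f 0) := by
    simpa [Fin.sum_univ_two] using hf.sum_nonneg ![x, 0] ![1, 1]
  exact abs_le.2 ⟨by linarith, by linarith⟩

protected lemma add (hf : IsRadialPosDef n f) (hg : IsRadialPosDef n g) :
    IsRadialPosDef n fun t => f t + g t := by
  refine ⟨hf.1.add hg.1, fun m x ξ => (add_nonneg (hf.2 m x ξ) (hg.2 m x ξ)).trans_eq ?_⟩
  push_cast
  simp only [← sum_add_distrib, add_mul]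

lemma const_mul (hf : IsRadialPosDef n f) {r : ℝ} (hr : 0 ≤ r) :
    IsRadialPosDef n fun t => r * f t := by
  refine ⟨hf.1.const_mul r, fun m x ξ =>
    (mul_nonneg (Complex.zero_le_real.2 hr) (hf.2 m x ξ)).trans_eq ?_⟩
  push_cast
  simp only [mul_sum, mul_assoc]

lemma comp_mul (hf : IsRadialPosDef n f) (r : ℝ≥0) : IsRadialPosDef n fun t => f (r * t) := by
  refine ⟨hf.1.comp (by fun_prop), fun m x ξ => ?_⟩
  convert hf.2 m (fun k => (r : ℝ) • x k) ξ using 7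
  rw [← smul_sub, nnnorm_smul, NNReal.nnnorm_eq]

lemma integral_comp_mul (hf : IsRadialPosDef n f) {w : ℝ → ℝ} (hw : Continuous w)
    (hw0 : ∀ y ∈ Set.Icc (0 : ℝ) 1, 0 ≤ w y) :
    IsRadialPosDef n fun t => ∫ y in (0 : ℝ)..1, f (y.toNNReal * t) * w y := by
  have hc := hf.1
  have integrable (t : ℝ≥0) :
      IntervalIntegrable (fun y : ℝ => f (y.toNNReal * t) * w y) volume 0 1 :=
    Continuous.intervalIntegrable (by fun_prop) 0 1
  refine isRadialPosDef_of_real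
    (intervalIntegral.continuous_parametric_intervalIntegral_of_continuous' (by fun_prop) 0 1)
    fun m x c => ?_
  have form : ∑ k, ∑ j, (∫ y in (0 : ℝ)..1, f (y.toNNReal * ‖x k - x j‖₊) * w y) * c j * c k =
      ∫ y in (0 : ℝ)..1,
        (∑ k, ∑ j, f (y.toNNReal * ‖x k - x j‖₊) * c j * c k) * w y := by
    simp_rw [mul_assoc, ← intervalIntegral.integral_mul_const,
      ← intervalIntegral.integral_finsetSum fun _ _ => (integrable _).mul_const (_ : ℝ)]
    rw [← intervalIntegral.integral_finsetSum fun k _ =>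
      Continuous.intervalIntegrable (by fun_prop) 0 1]
    simp only [mul_sum, mul_comm, mul_left_comm]
  rw [form]
  exact intervalIntegral.integral_nonneg zero_le_one fun y hy =>
    mul_nonneg ((hf.comp_mul y.toNNReal).sum_nonneg x c) (hw0 y hy)

end IsRadialPosDef

/-! ### The Schoenberg kernel and its products -/

lemma charFun_map_smul_uniformSphere {n : ℕ} (hn : 1 ≤ n) {a : ℝ} (ha : 0 ≤ a)
    (x : EuclideanSpace ℝ (Fin n)) :
    charFun ((uniformSphere (EuclideanSpace ℝ (Fin n))).map (a • ·)) x =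
      schoenbergKernel n (a * ‖x‖) := by
  have := nontrivial_euclideanSpace_fin hn
  rw [charFun_map_smul, charFun_uniformSphere, finrank_euclideanSpace_fin, norm_smul,
    Real.norm_of_nonneg ha]

lemma norm_eq_ae_map_smul_uniformSphere {n : ℕ} (hn : 1 ≤ n) {a : ℝ} (ha : 0 ≤ a) :
    ∀ᵐ y ∂(uniformSphere (EuclideanSpace ℝ (Fin n))).map (a • ·), ‖y‖ = a := by
  have := nontrivial_euclideanSpace_fin hn
  rw [ae_map_iff (by fun_prop) (measurableSet_eq_fun (by fun_prop) (by fun_prop))]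
  filter_upwards [norm_eq_one_ae_uniformSphere] with u hu
  rw [norm_smul, hu, mul_one, Real.norm_of_nonneg ha]

lemma isRadialPosDef_schoenbergKernel {n : ℕ} (hn : 1 ≤ n) :
    IsRadialPosDef n fun t => schoenbergKernel n t := by
  have := nontrivial_euclideanSpace_fin hn
  refine isRadialPosDef_of_charFun hn (μ := uniformSphere (EuclideanSpace ℝ (Fin n))) fun x => ?_
  rw [charFun_uniformSphere, finrank_euclideanSpace_fin, coe_nnnorm]

/-- The law of `a • U + b • V`, where `U` and `V` are independent and uniformly distributed on the
unit sphere of `ℝⁿ`. -/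
def sphereSumLaw (n : ℕ) (a b : ℝ) : Measure (EuclideanSpace ℝ (Fin n)) :=
  (uniformSphere _).map (a • ·) ∗ (uniformSphere _).map (b • ·)

instance (n : ℕ) (a b : ℝ) : IsProbabilityMeasure (sphereSumLaw n a b) := by
  have (r : ℝ) : IsProbabilityMeasure
      ((uniformSphere (EuclideanSpace ℝ (Fin n))).map (r • ·)) :=
    Measure.isProbabilityMeasure_map (by fun_prop)
  unfold sphereSumLaw
  infer_instance

lemma charFun_sphereSumLaw {n : ℕ} (hn : 1 ≤ n) {a b : ℝ} (ha : 0 ≤ a) (hb : 0 ≤ b)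
    (x : EuclideanSpace ℝ (Fin n)) : charFun (sphereSumLaw n a b) x =
      (schoenbergKernel n (a * ‖x‖₊) * schoenbergKernel n (b * ‖x‖₊) : ℝ) := by
  rw [sphereSumLaw, charFun_conv, charFun_map_smul_uniformSphere hn ha,
    charFun_map_smul_uniformSphere hn hb, Complex.ofReal_mul, coe_nnnorm]

lemma isRadialPosDef_schoenbergKernel_mul {n : ℕ} (hn : 1 ≤ n) {a b : ℝ} (ha : 0 ≤ a)
    (hb : 0 ≤ b) :
    IsRadialPosDef n fun t => schoenbergKernel n (a * t) * schoenbergKernel n (b * t) :=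
  isRadialPosDef_of_charFun hn (charFun_sphereSumLaw hn ha hb)

lemma abs_sub_le_norm_ae_sphereSumLaw {n : ℕ} (hn : 1 ≤ n) {a b : ℝ} (ha : 0 ≤ a) (hb : 0 ≤ b) :
    ∀ᵐ y ∂sphereSumLaw n a b, |a - b| ≤ ‖y‖ := by
  rw [sphereSumLaw, Measure.conv, ae_map_iff (by fun_prop)
    (measurableSet_le (by fun_prop) (by fun_prop))]
  filter_upwards [Measure.quasiMeasurePreserving_fst.ae (norm_eq_ae_map_smul_uniformSphere hn ha),
    Measure.quasiMeasurePreserving_snd.ae (norm_eq_ae_map_smul_uniformSphere hn hb)] with p hU hV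
  simpa [hU, hV] using abs_norm_sub_norm_le p.1 (-p.2)

/-! ### Gaussian means -/

lemma nonneg_of_forall_nonneg_add_nsmul {D Q : ℝ} (h : ∀ k : ℕ, 0 ≤ D + k • Q) : 0 ≤ Q := by
  by_contra! hQ
  obtain ⟨k, hk⟩ := exists_lt_nsmul (neg_pos.2 hQ) D
  have := h k
  rw [smul_neg] at hk
  linarith

/-- The diagonal terms of the sum over an i.i.d. sample of size `N` are negligible with respect to
its `N (N - 1)` other terms. -/
lemma integral_prod_nonneg_of_sum_nonneg {X : Type*} [MeasurableSpace X] {μ : Measure X}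
    [IsProbabilityMeasure μ] {K : X → X → ℝ} (hK : Measurable (Function.uncurry K)) {C : ℝ}
    (hC : ∀ x y, |K x y| ≤ C) (h : ∀ (N : ℕ) (x : Fin N → X), 0 ≤ ∑ i, ∑ j, K (x i) (x j)) :
    0 ≤ ∫ p, K p.1 p.2 ∂μ.prod μ := by
  refine nonneg_of_forall_nonneg_add_nsmul (D := ∫ x, K x x ∂μ) fun k => ?_
  let P : Measure (Fin (k + 1) → X) := Measure.pi fun _ => μ
  have law (i : Fin (k + 1)) : P.map (fun x => x i) = μ :=
    (measurePreserving_eval (fun _ => μ) i).map_eq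
  have independent : iIndepFun (fun i (x : Fin (k + 1) → X) => x i) P :=
    iIndepFun_pi fun i => aemeasurable_id
  have hcoord (i j) : Measurable fun x : Fin (k + 1) → X => (x i, x j) := by fun_prop
  have diagonal (i) : ∫ x, K (x i) (x i) ∂P = ∫ x, K x x ∂μ := by
    have hmeas : Measurable fun x => K x x := hK.comp (by fun_prop : Measurable fun x => (x, x))
    rw [← integral_map (μ := P) (f := fun x => K x x) (measurable_pi_apply i).aemeasurable
      hmeas.aestronglyMeasurable, law]
  have off_diagonal (i j) (hij : i ≠ j) :
      ∫ x, K (x i) (x j) ∂P = ∫ p, K p.1 p.2 ∂μ.prod μ := by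
    have pair := (indepFun_iff_map_prod_eq_prod_map_map (measurable_pi_apply i).aemeasurable
      (measurable_pi_apply j).aemeasurable).1 (independent.indepFun hij)
    rw [law, law] at pair
    rw [← pair]
    exact (integral_map (f := Function.uncurry K) (hcoord i j).aemeasurable
      hK.aestronglyMeasurable).symm
  have integrable (i j) : Integrable (fun x => K (x i) (x j)) P :=
    .of_bound (hK.comp (hcoord i j)).aestronglyMeasurable C (.of_forall fun x => hC _ _)
  have sample_sum : ∫ x, ∑ i, ∑ j, K (x i) (x j) ∂P =
      (k + 1) • (∫ x, K x x ∂μ + k • ∫ p, K p.1 p.2 ∂μ.prod μ) := by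
    rw [integral_finsetSum _ fun i _ => integrable_finsetSum _ fun j _ => integrable i j,
      sum_congr rfl fun i _ => ?_, sum_const, card_univ, Fintype.card_fin]
    rw [integral_finsetSum _ fun j _ => integrable i j, ← add_sum_erase _ _ (mem_univ i), diagonal,
      sum_congr rfl fun j hj => off_diagonal i j (ne_of_mem_erase hj).symm, sum_const,
      card_erase_of_mem (mem_univ i), card_univ, Fintype.card_fin, Nat.add_sub_cancel]
  have nonneg : 0 ≤ ∫ x, ∑ i, ∑ j, K (x i) (x j) ∂P := integral_nonneg fun x => h _ x
  rw [sample_sum, nsmul_eq_mul] at nonneg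
  exact nonneg_of_mul_nonneg_right nonneg (by positivity)

lemma map_smul_sub_smul_stdGaussian {E : Type*} [NormedAddCommGroup E] [InnerProductSpace ℝ E]
    [FiniteDimensional ℝ E] [MeasurableSpace E] [BorelSpace E] {r q R : ℝ}
    (h : R ^ 2 = r ^ 2 + q ^ 2) :
    ((stdGaussian E).prod (stdGaussian E)).map (fun p => r • p.1 - q • p.2) =
      (stdGaussian E).map fun x => R • x := by
  have : IsProbabilityMeasure (((stdGaussian E).prod (stdGaussian E)).map
    (fun p => r • p.1 - q • p.2)) := Measure.isProbabilityMeasure_map (by fun_prop)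
  have : IsProbabilityMeasure ((stdGaussian E).map fun x => R • x) :=
    Measure.isProbabilityMeasure_map (by fun_prop)
  refine Measure.ext_of_charFun (funext fun t => ?_)
  have as_conv : ((stdGaussian E).prod (stdGaussian E)).map (fun p => r • p.1 - q • p.2) =
      (stdGaussian E).map (r • ·) ∗ (stdGaussian E).map (-q • ·) := by
    rw [Measure.conv, Measure.map_prod_map _ _ (by fun_prop) (by fun_prop),
      Measure.map_map (by fun_prop) (by fun_prop)]
    simp [Function.comp_def, sub_eq_add_neg]
  have (r : ℝ) : IsProbabilityMeasure ((stdGaussian E).map (r • ·)) :=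
    Measure.isProbabilityMeasure_map (by fun_prop)
  rw [as_conv, charFun_conv, charFun_map_smul, charFun_map_smul, charFun_map_smul,
    charFun_stdGaussian, charFun_stdGaussian, charFun_stdGaussian, ← Complex.exp_add]
  congr 1
  simp only [norm_smul, norm_neg, Real.norm_eq_abs]
  norm_cast
  simp only [mul_pow, sq_abs]
  rw [h]
  ring

/-- The mean of the radial function `f(|x|)` on `ℝᵈ` with respect to the centred Gaussian measure
of variance `s`; the value at a negative `s` is meaningless. -/
def gaussianMean (d : ℕ) (f : ℝ≥0 → ℝ) (s : ℝ) : ℝ :=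
  ∫ y, f ‖√s • y‖₊ ∂stdGaussian (EuclideanSpace ℝ (Fin d))

/-- Positive definite functions on the additive semigroup `[0, ∞)` with the identity involution;
only the values of `G` on `[0, ∞)` matter. -/
def IsSemigroupPosDef (G : ℝ → ℝ) : Prop :=
  ∀ {ι : Type} [Fintype ι] (s : ι → ℝ≥0) (c : ι → ℝ),
    0 ≤ ∑ i, ∑ j, G (s i + s j) * c j * c i

lemma IsSemigroupPosDef.nonneg {G : ℝ → ℝ} (hG : IsSemigroupPosDef G) (s : ℝ≥0) : 0 ≤ G s := by
  simpa [← NNReal.coe_add] using hG (fun _ : Unit => s / 2) 1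

lemma integral_smul_sub_smul_eq_gaussianMean {d : ℕ} {f : ℝ≥0 → ℝ} (hf : Measurable f)
    (s t : ℝ≥0) : ∫ p, f ‖√(s : ℝ) • p.1 - √(t : ℝ) • p.2‖₊
      ∂(stdGaussian (EuclideanSpace ℝ (Fin d))).prod (stdGaussian _) =
        gaussianMean d f (s + t) := by
  have law := map_smul_sub_smul_stdGaussian (E := EuclideanSpace ℝ (Fin d))
    (R := √(s + t : ℝ)) (r := √(s : ℝ)) (q := √(t : ℝ))
    (by simp only [Real.sq_sqrt, NNReal.zero_le_coe, add_nonneg])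
  calc _ = ∫ z, f ‖z‖₊ ∂((stdGaussian (EuclideanSpace ℝ (Fin d))).prod (stdGaussian _)).map
        (fun p => √(s : ℝ) • p.1 - √(t : ℝ) • p.2) := by
        rw [integral_map (by fun_prop) (by fun_prop : Measurable _).aestronglyMeasurable]
    _ = _ := by rw [law, integral_map (by fun_prop)
        (by fun_prop : Measurable _).aestronglyMeasurable, gaussianMean]

lemma IsRadialPosDef.isSemigroupPosDef_gaussianMean {d : ℕ} {f : ℝ≥0 → ℝ}
    (hf : IsRadialPosDef d f) : IsSemigroupPosDef (gaussianMean d f) := by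
  intro ι _ s c
  have hfm := hf.1.measurable
  let E := EuclideanSpace ℝ (Fin d)
  let K (x y : E) : ℝ := ∑ i, ∑ j, f ‖√(s i : ℝ) • x - √(s j : ℝ) • y‖₊ * c j * c i
  have bound (x y : E) : |K x y| ≤ ∑ i, ∑ j, f 0 * |c j| * |c i| :=
    (abs_sum_le_sum_abs _ _).trans <| sum_le_sum fun i _ => (abs_sum_le_sum_abs _ _).trans <|
      sum_le_sum fun j _ => by
        rw [abs_mul, abs_mul]
        gcongr
        exact hf.abs_apply_nnnorm_le _
  have positive (N : ℕ) (x : Fin N → E) : 0 ≤ ∑ a, ∑ b, K (x a) (x b) := by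
    have h := hf.sum_nonneg (fun p : Fin N × ι => √(s p.2 : ℝ) • x p.1) fun p => c p.2
    simp only [Fintype.sum_prod_type] at h
    refine h.trans_eq (sum_congr rfl fun a _ => ?_)
    rw [sum_comm]
  have integrable (i j) : Integrable
      (fun p : E × E => f ‖√(s i : ℝ) • p.1 - √(s j : ℝ) • p.2‖₊)
      ((stdGaussian E).prod (stdGaussian E)) :=
    .of_bound (by fun_prop : Measurable _).aestronglyMeasurable (f 0)
      (.of_forall fun p => hf.abs_apply_nnnorm_le _)
  have form : ∫ p, K p.1 p.2 ∂(stdGaussian E).prod (stdGaussian E) =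
      ∑ i, ∑ j, gaussianMean d f (s i + s j) * c j * c i := by
    rw [integral_finsetSum _ fun i _ => integrable_finsetSum _ fun j _ =>
      ((integrable i j).mul_const _).mul_const _]
    refine sum_congr rfl fun i _ => ?_
    rw [integral_finsetSum _ fun j _ => ((integrable i j).mul_const _).mul_const _]
    refine sum_congr rfl fun j _ => ?_
    rw [integral_mul_const, integral_mul_const, integral_smul_sub_smul_eq_gaussianMean hfm]
  rw [← form]
  exact integral_prod_nonneg_of_sum_nonneg (by fun_prop) bound positive

lemma HasGaussianSeries.gaussianMean {d : ℕ} (hd : 1 ≤ d) {e : ℕ → ℝ} {f : ℝ≥0 → ℝ}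
    (h : HasGaussianSeries e f) {s : ℝ} (hs : 0 ≤ s) :
    HasSum (fun k => e k * (d / 2 : ℝ)⁽k⁾ * (-(s / 2)) ^ k) (gaussianMean d f s) := by
  have := nontrivial_euclideanSpace_fin hd
  have term (y : EuclideanSpace ℝ (Fin d)) (k : ℕ) :
      e k * (-((‖√s • y‖₊ : ℝ) ^ 2 / 4)) ^ k = e k * (-(s / 4)) ^ k * ‖y‖ ^ (2 * k) := by
    rw [coe_nnnorm, norm_smul, mul_pow, Real.norm_eq_abs, sq_abs, Real.sq_sqrt hs, pow_mul,
      mul_assoc, ← mul_pow]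
    ring_nf
  have term_mean (a r : ℝ) (k : ℕ) :
      ∫ y, a * r ^ k * ‖y‖ ^ (2 * k) ∂stdGaussian (EuclideanSpace ℝ (Fin d)) =
        a * (d / 2 : ℝ)⁽k⁾ * (2 * r) ^ k := by
    rw [integral_const_mul, integral_norm_pow_stdGaussian, finrank_euclideanSpace_fin, mul_pow]
    ring
  have integrable (k : ℕ) : Integrable (fun y => e k * (-(s / 4)) ^ k * ‖y‖ ^ (2 * k))
      (stdGaussian (EuclideanSpace ℝ (Fin d))) := by
    have h := (IsGaussian.memLp_id (stdGaussian (EuclideanSpace ℝ (Fin d))) (2 * k : ℕ)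
      (ENNReal.natCast_ne_top _)).integrable_norm_pow'
    exact h.const_mul _
  have hd0 : (0 : ℝ) < d / 2 := by positivity
  have double : 2 * -(s / 4) = -(s / 2) := by ring
  have summable : Summable fun k => ∫ y, ‖e k * (-(s / 4)) ^ k * ‖y‖ ^ (2 * k)‖
      ∂stdGaussian (EuclideanSpace ℝ (Fin d)) := by
    refine (h.summable_pochhammer hd0 (-(s / 2))).congr fun k => ?_
    simp_rw [norm_mul, norm_pow, norm_norm]
    rw [term_mean, abs_mul, abs_mul, abs_pow, abs_of_pos (ascPochhammer_pos k _ hd0), ← double,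
      abs_mul, abs_two, Real.norm_eq_abs, Real.norm_eq_abs]
  have series := hasSum_integral_of_summable_integral_norm integrable summable
  simp_rw [← term, (h.hasSum _).tsum_eq, term, term_mean, double] at series
  exact series

/-! ### Products of two different dilations in dimension `n + 1` -/

lemma integral_charFun_comm {E : Type*} [NormedAddCommGroup E] [InnerProductSpace ℝ E]
    [SecondCountableTopology E] [MeasurableSpace E] [BorelSpace E] (μ ν : Measure E)
    [IsFiniteMeasure μ] [IsFiniteMeasure ν] :
    ∫ x, charFun μ x ∂ν = ∫ y, charFun ν y ∂μ := by
  simp_rw [charFun_apply]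
  rw [integral_integral_swap]
  · simp_rw [real_inner_comm]
  · refine .of_bound (by fun_prop : Measurable _).aestronglyMeasurable 1 (.of_forall fun p => ?_)
    exact (Complex.norm_exp_ofReal_mul_I _).le

lemma eq_integral_schoenbergKernel_of_charFun {n : ℕ} (hn : 1 ≤ n) {f : ℝ≥0 → ℝ}
    {μ : Measure (EuclideanSpace ℝ (Fin n))} [IsFiniteMeasure μ]
    (h : ∀ x, charFun μ x = f ‖x‖₊) (t : ℝ≥0) :
    f t = ∫ y, schoenbergKernel n (t * ‖y‖) ∂μ := by
  let ν := (uniformSphere (EuclideanSpace ℝ (Fin n))).map ((t : ℝ) • ·)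
  have : IsProbabilityMeasure ν := Measure.isProbabilityMeasure_map (by fun_prop)
  have charFun_eq : ∀ᵐ x ∂ν, charFun μ x = f t := by
    filter_upwards [norm_eq_ae_map_smul_uniformSphere hn t.coe_nonneg] with x hx
    rw [h, show ‖x‖₊ = t from NNReal.eq hx]
  have parseval := integral_charFun_comm μ ν
  rw [integral_congr_ae charFun_eq, integral_const, probReal_univ, one_smul,
    integral_congr_ae (.of_forall (charFun_map_smul_uniformSphere hn t.coe_nonneg))] at parseval
  exact_mod_cast parseval.trans integral_complex_ofReal

lemma gaussianMean_comp_mul (d : ℕ) (f : ℝ≥0 → ℝ) (r : ℝ≥0) (s : ℝ) :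
    gaussianMean d (fun t => f (r * t)) s = gaussianMean d f (r ^ 2 * s) := by
  refine integral_congr_ae (.of_forall fun x => ?_)
  have : √(r ^ 2 * s : ℝ) = r * √s := by
    rw [Real.sqrt_mul (by positivity), Real.sqrt_sq r.coe_nonneg]
  dsimp only
  rw [this, mul_smul, nnnorm_smul (r : ℝ), NNReal.nnnorm_eq]

lemma abs_schoenbergKernel_le_one {n : ℕ} (hn : 1 ≤ n) (t : ℝ≥0) : |schoenbergKernel n t| ≤ 1 := by
  have := nontrivial_euclideanSpace_fin hn
  obtain ⟨x, hx⟩ := exists_norm_eq (EuclideanSpace ℝ (Fin n)) t.2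
  have h := (isRadialPosDef_schoenbergKernel hn).abs_apply_nnnorm_le x
  have h0 := charFun_uniformSphere (0 : EuclideanSpace ℝ (Fin n))
  rw [charFun_zero, probReal_univ, finrank_euclideanSpace_fin, norm_zero] at h0
  rw [NNReal.coe_zero, ← Complex.ofReal_inj.1 h0, coe_nnnorm, hx] at h
  exact h

lemma gaussianMean_eq_integral_of_charFun {n d : ℕ} (hn : 1 ≤ n) {f : ℝ≥0 → ℝ}
    {μ : Measure (EuclideanSpace ℝ (Fin n))} [IsFiniteMeasure μ]
    (h : ∀ x, charFun μ x = f ‖x‖₊) (s : ℝ) :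
    Integrable (fun y => gaussianMean d (fun t => schoenbergKernel n t) (‖y‖ ^ 2 * s)) μ ∧
    gaussianMean d f s =
      ∫ y, gaussianMean d (fun t => schoenbergKernel n t) (‖y‖ ^ 2 * s) ∂μ := by
  let γ := stdGaussian (EuclideanSpace ℝ (Fin d))
  let K (t : ℝ≥0) : ℝ := schoenbergKernel n t
  have hK : Continuous K := (isRadialPosDef_schoenbergKernel hn).1
  have integrable : Integrable (fun p : EuclideanSpace ℝ (Fin d) × EuclideanSpace ℝ (Fin n) =>
      K (‖p.2‖₊ * ‖√s • p.1‖₊)) (γ.prod μ) :=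
    .of_bound (by fun_prop : Measurable _).aestronglyMeasurable 1
      (.of_forall fun p => abs_schoenbergKernel_le_one hn _)
  have mean (y : EuclideanSpace ℝ (Fin n)) :
      ∫ x, K (‖y‖₊ * ‖√s • x‖₊) ∂γ = gaussianMean d K (‖y‖ ^ 2 * s) :=
    gaussianMean_comp_mul d K ‖y‖₊ s
  refine ⟨integrable.integral_prod_right.congr (.of_forall mean), ?_⟩
  simp_rw [gaussianMean, eq_integral_schoenbergKernel_of_charFun hn h, mul_comm (NNReal.toReal _)]
  rw [integral_integral_swap integrable]
  exact integral_congr_ae (.of_forall mean)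

lemma gaussianMean_succ_schoenbergKernel_neg {n : ℕ} (hn : 1 ≤ n) {s : ℝ} (hs : 2 * n < s) :
    gaussianMean (n + 1) (fun t => schoenbergKernel n t) s < 0 := by
  have hn0 : (0 : ℝ) < n / 2 := by positivity
  have hs0 : 0 ≤ s := by linarith
  let a (k : ℕ) : ℝ := Ring.choose (1 / 2 : ℝ) k / (n / 2 : ℝ)⁽k⁾ * (-(s / 2)) ^ k
  have summable : Summable a := (summable_abs_choose_div_pochhammer_mul_pow _ hn0 _).of_abs
  have mean_eq : gaussianMean (n + 1) (fun t => schoenbergKernel n t) s =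
      Real.exp (-(s / 2)) * ∑' k, a k := by
    refine ((hasGaussianSeries_schoenbergKernel hn).gaussianMean n.succ_pos hs0).unique ?_
    convert hasSum_kummer hn0 (1 / 2) (-(s / 2)) using 3 with k
    rw [mul_comm]
    push_cast
    ring_nf
  have tail_nonpos (k : ℕ) : a (k + 2) ≤ 0 := by
    have h := neg_one_pow_mul_choose_succ_nonpos (a := 1 / 2) (by norm_num) (by norm_num) (k + 1)
    have hpos := ascPochhammer_pos (k + 2) _ hn0
    calc a (k + 2) = ((-1) ^ (k + 2) * Ring.choose (1 / 2 : ℝ) (k + 2)) *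
          ((s / 2) ^ (k + 2) / (n / 2 : ℝ)⁽(k + 2)⁾) := by
          simp only [a]
          rw [neg_pow]
          ring
      _ ≤ 0 := mul_nonpos_of_nonpos_of_nonneg h (by positivity)
  rw [mean_eq]
  refine mul_neg_of_pos_of_neg (Real.exp_pos _) ?_
  calc ∑' k, a k = a 0 + a 1 + ∑' k, a (k + 2) := by
        rw [← summable.sum_add_tsum_nat_add 2, sum_range_succ, sum_range_one]
    _ ≤ 1 - s / (2 * n) + 0 := by
        gcongr
        · rw [show a 0 = 1 by simp [a], show a 1 = -(s / (2 * n)) by simp [a]; field_simp]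
          linarith
        · exact tsum_nonpos tail_nonpos
    _ < 0 := by
        rw [add_zero, sub_neg, lt_div_iff₀ (by positivity)]
        linarith

lemma not_isRadialPosDef_succ_of_charFun {n : ℕ} (hn : 1 ≤ n) {f : ℝ≥0 → ℝ}
    {μ : Measure (EuclideanSpace ℝ (Fin n))} [IsFiniteMeasure μ] [NeZero μ]
    (h : ∀ x, charFun μ x = f ‖x‖₊) {δ : ℝ} (hδ : 0 < δ) (hμ : ∀ᵐ y ∂μ, δ ≤ ‖y‖) :
    ¬IsRadialPosDef (n + 1) f := by
  intro hf
  obtain ⟨s, hs⟩ : ∃ s : ℝ≥0, 2 * n < δ ^ 2 * s := by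
    refine ⟨((2 * n + 1) / δ ^ 2).toNNReal, ?_⟩
    rw [Real.coe_toNNReal _ (by positivity), mul_div_cancel₀ _ (by positivity)]
    linarith
  obtain ⟨integrable, mean_eq⟩ := gaussianMean_eq_integral_of_charFun (d := n + 1) hn h s
  have neg : ∀ᵐ y ∂μ, gaussianMean (n + 1) (fun t => schoenbergKernel n t) (‖y‖ ^ 2 * s) < 0 := by
    filter_upwards [hμ] with y hy
    exact gaussianMean_succ_schoenbergKernel_neg hn (hs.trans_le (by gcongr))
  have nonneg := IsSemigroupPosDef.nonneg hf.isSemigroupPosDef_gaussianMean s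
  rw [mean_eq] at nonneg
  obtain ⟨y, hy, hle⟩ := exists_notMem_null_average_le (NeZero.ne μ) integrable neg
  rw [average_eq] at hle
  exact hy ((smul_nonneg (by positivity) nonneg).trans hle).not_gt

lemma not_isRadialPosDef_succ_schoenbergKernel_mul {n : ℕ} (hn : 1 ≤ n) {a b : ℝ} (ha : 0 ≤ a)
    (hb : 0 ≤ b) (hab : a ≠ b) :
    ¬IsRadialPosDef (n + 1) fun t => schoenbergKernel n (a * t) * schoenbergKernel n (b * t) :=
  not_isRadialPosDef_succ_of_charFun hn (charFun_sphereSumLaw hn ha hb)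
    (abs_pos.2 (sub_ne_zero.2 hab)) (abs_sub_le_norm_ae_sphereSumLaw hn ha hb)

/-! ### The square of the kernel in dimension `2 * n` -/

lemma nonneg_of_hasDerivAt_of_nonneg {F F' : ℝ → ℝ} {c : ℝ} (hF : ∀ h, HasDerivAt F (F' h) h)
    (hF' : HasDerivAt F' c 0) (h0 : F 0 = 0) (h1 : F' 0 = 0) (hpos : ∀ h, 0 ≤ h → 0 ≤ F h) :
    0 ≤ c := by
  by_contra! hc
  let f (h : ℝ) : ℝ := F h - c / 4 * h ^ 2
  have deriv_f : deriv f = fun h => F' h - c / 2 * h := by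
    ext h
    refine HasDerivAt.deriv (((hF h).sub ((hasDerivAt_pow 2 h).const_mul (c / 4))).congr_deriv ?_)
    push_cast
    ring
  have deriv_deriv_f : deriv (deriv f) 0 = c / 2 := by
    rw [deriv_f]
    refine HasDerivAt.deriv ((hF'.sub ((hasDerivAt_id 0).const_mul (c / 2))).congr_deriv ?_)
    ring
  have localMax : IsLocalMax f 0 := isLocalMax_of_deriv_deriv_neg (by linarith)
    (by simp [deriv_f, h1]) ((hF 0).continuousAt.sub (by fun_prop))
  have : ∀ᶠ h in 𝓝[>] (0 : ℝ), f h ≤ f 0 ∧ 0 < h :=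
    (localMax.filter_mono nhdsWithin_le_nhds).and self_mem_nhdsWithin
  obtain ⟨h, hmax, hh⟩ := this.exists
  have := hpos h hh.le
  have : c * h ^ 2 < 0 := mul_neg_of_neg_of_pos hc (by positivity)
  simp only [f, h0] at hmax
  linarith

lemma hasDerivAt_iteratedDeriv {G : ℝ → ℝ} {m k : ℕ} (hG : ContDiff ℝ m G) (hk : k < m) (z : ℝ) :
    HasDerivAt (iteratedDeriv k G) (iteratedDeriv (k + 1) G z) z := by
  rw [iteratedDeriv_succ]
  exact (hG.differentiable_iteratedDeriv k (by exact_mod_cast hk) z).hasDerivAt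

namespace IsSemigroupPosDef

variable {G : ℝ → ℝ}

lemma sum_add_nonneg (hG : IsSemigroupPosDef G) {ι : Type} [Fintype ι] (s : ι → ℝ≥0) (c : ι → ℝ)
    (h : ℝ≥0) : 0 ≤ ∑ i, ∑ j, (G (s i + s j) - 2 * G (s i + s j + h) + G (s i + s j + 2 * h)) *
      c j * c i := by
  convert hG (Sum.elim s fun i => s i + h) (Sum.elim c (-c)) using 1
  simp only [Fintype.sum_sum_type, Sum.elim_inl, Sum.elim_inr, ← sum_add_distrib, Pi.neg_apply,
    NNReal.coe_add]
  refine sum_congr rfl fun i _ => sum_congr rfl fun j _ => ?_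
  rw [← add_assoc (s i : ℝ), add_right_comm (s i : ℝ) h (s j),
    show (s i + h + (s j + h) : ℝ) = s i + s j + 2 * h by ring]
  ring

lemma of_hasDerivAt {G' G'' : ℝ → ℝ} (hG : IsSemigroupPosDef G)
    (hG' : ∀ z, HasDerivAt G (G' z) z) (hG'' : ∀ z, HasDerivAt G' (G'' z) z) :
    IsSemigroupPosDef G'' := by
  intro ι _ s c
  let F (h : ℝ) : ℝ :=
    ∑ i, ∑ j, (G (s i + s j) - 2 * G (s i + s j + h) + G (s i + s j + 2 * h)) * c j * c i
  let F' (h : ℝ) : ℝ :=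
    ∑ i, ∑ j, (2 * G' (s i + s j + 2 * h) - 2 * G' (s i + s j + h)) * c j * c i
  have shift (x : ℝ) (h : ℝ) : HasDerivAt (x + ·) 1 h := (hasDerivAt_id h).const_add x
  have shift_two (x : ℝ) (h : ℝ) : HasDerivAt (fun h => x + 2 * h) 2 h := by
    simpa using ((hasDerivAt_id h).const_mul 2).const_add x
  have hF (h : ℝ) : HasDerivAt F (F' h) h := by
    refine .fun_sum fun i _ => .fun_sum fun j _ => .mul_const (.mul_const ?_ _) _
    have d := (((hG' _).comp h (shift (s i + s j) h)).const_mul 2).const_sub (G (s i + s j))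
    exact (d.add ((hG' _).comp h (shift_two (s i + s j) h))).congr_deriv (by ring)
  have hF' : HasDerivAt F' (∑ i, ∑ j, 2 * G'' (s i + s j) * c j * c i) 0 := by
    refine .fun_sum fun i _ => .fun_sum fun j _ => .mul_const (.mul_const ?_ _) _
    have d := ((hG'' _).comp 0 (shift_two (s i + s j) 0)).const_mul 2
    refine (d.sub (((hG'' _).comp 0 (shift (s i + s j) 0)).const_mul 2)).congr_deriv ?_
    simp only [mul_zero, add_zero]
    ring
  have := nonneg_of_hasDerivAt_of_nonneg hF hF' (by simp [F, two_mul, sub_add_eq_add_sub])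
    (by simp [F']) fun h hh => hG.sum_add_nonneg s c ⟨h, hh⟩
  simpa [mul_assoc, ← mul_sum] using this

lemma sq_apply_le (hG : IsSemigroupPosDef G) (h : ℝ≥0) : G h ^ 2 ≤ G 0 * G (2 * h) := by
  have disc := discrim_le_zero (a := G 0) (b := 2 * G h) (c := G (2 * h)) fun x => by
    have := hG ![0, h] ![x, 1]
    simp only [Fin.sum_univ_two, Matrix.cons_val_zero, Matrix.cons_val_one, NNReal.coe_zero,
      zero_add, add_zero, ← two_mul, mul_one] at this
    linarith
  rw [discrim] at disc
  linarith

lemma sq_le_of_hasDerivAt {G' : ℝ → ℝ} {c : ℝ} (hG : IsSemigroupPosDef G)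
    (hG' : ∀ z, HasDerivAt G (G' z) z) (hc : HasDerivAt G' c 0) : G' 0 ^ 2 ≤ G 0 * c := by
  have double (h : ℝ) : HasDerivAt (fun h => 2 * h) 2 h := by
    simpa using (hasDerivAt_id h).const_mul (2 : ℝ)
  have hF (h : ℝ) : HasDerivAt (fun h => G 0 * G (2 * h) - G h ^ 2)
      (2 * (G 0 * G' (2 * h) - G h * G' h)) h := by
    refine ((((hG' _).comp h (double h)).const_mul (G 0)).sub ((hG' h).pow 2)).congr_deriv ?_
    push_cast
    ring
  have hF' : HasDerivAt (fun h => 2 * (G 0 * G' (2 * h) - G h * G' h)) (2 * (G 0 * c - G' 0 ^ 2))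
      0 := by
    have hc₂ : HasDerivAt G' c (2 * 0) := by rwa [mul_zero]
    refine (((hc₂.comp 0 (double 0)).const_mul (G 0)).sub ((hG' 0).mul hc)).const_mul 2
      |>.congr_deriv ?_
    ring
  have := nonneg_of_hasDerivAt_of_nonneg hF hF' (by simp [sq]) (by simp)
    fun h hh => sub_nonneg.2 (hG.sq_apply_le ⟨h, hh⟩)
  linarith

lemma iteratedDeriv (hG : IsSemigroupPosDef G) {m : ℕ} (hm : ContDiff ℝ (2 * m : ℕ) G) :
    IsSemigroupPosDef (iteratedDeriv (2 * m) G) := by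
  induction m with
  | zero => rwa [mul_zero, iteratedDeriv_zero]
  | succ m ih =>
    exact of_hasDerivAt (ih (hm.of_le (by norm_cast; lia)))
      (hasDerivAt_iteratedDeriv hm (by lia)) (hasDerivAt_iteratedDeriv hm (by lia))

lemma sq_iteratedDeriv_le (hG : IsSemigroupPosDef G) {m : ℕ}
    (hm : ContDiff ℝ (2 * (m + 1) : ℕ) G) :
    _root_.iteratedDeriv (2 * m + 1) G 0 ^ 2 ≤
      _root_.iteratedDeriv (2 * m) G 0 * _root_.iteratedDeriv (2 * (m + 1)) G 0 :=
  sq_le_of_hasDerivAt (iteratedDeriv hG (hm.of_le (by norm_cast; lia)))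
    (hasDerivAt_iteratedDeriv hm (by lia)) (hasDerivAt_iteratedDeriv hm (by lia) 0)

end IsSemigroupPosDef

open FormalMultilinearSeries in
lemma contDiff_and_iteratedDeriv_zero_of_hasSum {a : ℕ → ℝ} {G : ℝ → ℝ}
    (h : ∀ z, HasSum (fun k => a k * z ^ k) (G z)) (m : ℕ) :
    ContDiff ℝ m G ∧ iteratedDeriv m G 0 = m ! * a m := by
  have radius : (ofScalars ℝ a).radius = ⊤ :=
    radius_eq_top_of_summable_norm _ fun r => by
      simpa [abs_mul] using (h r).summable.abs
  have series : HasFPowerSeriesOnBall G (ofScalars ℝ a) 0 ⊤ :=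
    ⟨radius.ge, ENNReal.zero_lt_top, fun {z} _ => by simpa [mul_comm] using h z⟩
  have analytic (z : ℝ) : AnalyticAt ℝ G z := series.analyticOnNhd z (by simp)
  refine ⟨contDiff_iff_contDiffAt.2 fun z => (analytic z).contDiffAt, ?_⟩
  have taylor := (analytic 0).hasFPowerSeriesAt.eq_formalMultilinearSeries series.hasFPowerSeriesAt
  have coeff_eq := congrFun (ofScalars_series_injective ℝ ℝ taylor) m
  rw [← coeff_eq, mul_div_cancel₀ _ (by positivity)]

lemma IsSemigroupPosDef.sq_coeff_le {a : ℕ → ℝ} {G : ℝ → ℝ} (hG : IsSemigroupPosDef G)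
    (h : ∀ s, 0 ≤ s → HasSum (fun k => a k * s ^ k) (G s)) (m : ℕ) :
    ((2 * m + 1)! * a (2 * m + 1)) ^ 2 ≤
      ((2 * m)! * a (2 * m)) * ((2 * (m + 1))! * a (2 * (m + 1))) := by
  have series (z : ℝ) : HasSum (fun k => a k * z ^ k) (∑' k, a k * z ^ k) := by
    refine Summable.hasSum (Summable.of_abs ?_)
    simpa [abs_mul] using (h |z| (abs_nonneg z)).summable.abs
  have hG' : IsSemigroupPosDef fun z => ∑' k, a k * z ^ k := by
    intro ι _ s c
    simpa only [(h _ (add_nonneg (s _).coe_nonneg (s _).coe_nonneg)).tsum_eq] using hG s c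
  have jet := contDiff_and_iteratedDeriv_zero_of_hasSum series
  simpa only [jet] using hG'.sq_iteratedDeriv_le (m := m) (jet _).1

/-- The `k`-th derivative at `0` of the Gaussian mean of `Ω_n ^ 2` in dimension `2 * n`. -/
def sqMoment (n k : ℕ) : ℝ := k ! * (besselSqCoeff (n / 2) k * (n : ℝ)⁽k⁾ * (-1 / 2) ^ k)

lemma sqMoment_ne_zero {n : ℕ} (hn : 1 ≤ n) (k : ℕ) : sqMoment n k ≠ 0 := by
  have hn0 : (0 : ℝ) < n := by positivity
  have := besselSqCoeff_pos (half_pos hn0) k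
  have := ascPochhammer_pos k _ hn0
  exact mul_ne_zero (by positivity) (mul_ne_zero (by positivity) (pow_ne_zero _ (by norm_num)))

lemma sqMoment_succ {n : ℕ} (hn : 1 ≤ n) (k : ℕ) :
    (n + 2 * k) * (n + k - 1) * sqMoment n (k + 1) =
      -2 * (n + k) * (n + 2 * k - 1) * sqMoment n k := by
  have h := besselSqCoeff_succ (ν := n / 2) (by positivity) k
  rw [sqMoment, sqMoment, ascPochhammer_succ_eval, Nat.factorial_succ, pow_succ]
  push_cast
  linear_combination (-1) * k ! * (n : ℝ)⁽k⁾ * (n + k) * (-1 / 2) ^ k * h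

/-- The ratio `-2 * (1 + k / ((n + 2 * k) * (n + k - 1)))` of consecutive moments decreases in
modulus from `k = 2 * n` to `k = 2 * n + 1`. -/
lemma sqMoment_mul_lt_sq {n : ℕ} (hn : 1 ≤ n) :
    sqMoment n (2 * n) * sqMoment n (2 * (n + 1)) < sqMoment n (2 * n + 1) ^ 2 := by
  have hn1 : (1 : ℝ) ≤ n := by exact_mod_cast hn
  have ratio₀ := sqMoment_succ hn (2 * n)
  have ratio₁ := sqMoment_succ hn (2 * n + 1)
  have hM := sqMoment_ne_zero hn (2 * n + 1)
  push_cast at ratio₀ ratio₁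
  rw [show 2 * (n + 1) = 2 * n + 1 + 1 by ring]
  generalize (n : ℝ) = x at *
  generalize sqMoment n (2 * n) = M₀, sqMoment n (2 * n + 1) = M₁,
    sqMoment n (2 * n + 1 + 1) = M₂ at *
  have ratio₀' : 5 * (3 * x - 1) * M₁ = -6 * (5 * x - 1) * M₀ :=
    mul_left_cancel₀ (by positivity : x ≠ 0) (by linear_combination ratio₀)
  have product : 18 * x * (5 * x - 1) * (5 * x + 2) * (M₁ ^ 2 - M₀ * M₂) =
      2 * (7 * x + 5) * M₁ ^ 2 := by
    linear_combination (-6) * (5 * x - 1) * M₀ * ratio₁ +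
      2 * (3 * x + 1) * (5 * x + 1) * M₁ * ratio₀'
  have factor_pos : 0 < 18 * x * (5 * x - 1) * (5 * x + 2) :=
    mul_pos (mul_pos (by positivity) (by linarith)) (by positivity)
  have : 0 < 2 * (7 * x + 5) * M₁ ^ 2 := by positivity
  exact sub_pos.1 (pos_of_mul_pos_right (product ▸ this) factor_pos.le)

lemma not_isRadialPosDef_schoenbergKernel_sq {n : ℕ} (hn : 1 ≤ n) :
    ¬IsRadialPosDef (2 * n) fun t => schoenbergKernel n t ^ 2 := fun h => by
  have series (s : ℝ) (hs : 0 ≤ s) :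
      HasSum (fun k => besselSqCoeff (n / 2) k * (n : ℝ)⁽k⁾ * (-1 / 2) ^ k * s ^ k)
        (gaussianMean (2 * n) (fun t => schoenbergKernel n t ^ 2) s) := by
    convert (hasGaussianSeries_schoenbergKernel_sq hn).gaussianMean (by lia : 1 ≤ 2 * n) hs
      using 2 with k
    rw [show -(s / 2) = -1 / 2 * s by ring, mul_pow]
    push_cast
    rw [mul_div_cancel_left₀ _ two_ne_zero, mul_assoc]
  exact (sqMoment_mul_lt_sq hn).not_ge
    (IsSemigroupPosDef.sq_coeff_le h.isSemigroupPosDef_gaussianMean series n)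

/-! ### The square of the kernel in dimension `2 * n - 1` -/

lemma hasSum_integral_comp_mul {e : ℕ → ℝ} {f : ℝ≥0 → ℝ} {w : ℝ → ℝ}
    (hf : ∀ t : ℝ≥0, HasSum (fun k => e k * (-(t ^ 2 / 4 : ℝ)) ^ k) (f t)) (hw : Continuous w)
    (t : ℝ≥0) :
    HasSum (fun k => (∫ y in (0 : ℝ)..1, y ^ (2 * k) * w y) * e k * (-(t ^ 2 / 4 : ℝ)) ^ k)
      (∫ y in (0 : ℝ)..1, f (y.toNNReal * t) * w y) := by
  have termwise := intervalIntegral.hasSum_integral_of_dominated_convergence (μ := volume)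
    (a := 0) (b := 1) (f := fun y => f (y.toNNReal * t) * w y)
    (F := fun k y => e k * (-(t ^ 2 / 4 : ℝ)) ^ k * (y ^ (2 * k) * w y))
    (fun k y => |e k * (-(t ^ 2 / 4 : ℝ)) ^ k| * |w y|)
    (fun k => Continuous.aestronglyMeasurable (by fun_prop)) (fun k => .of_forall fun y hy => ?_)
    (.of_forall fun y _ => (hf t).summable.abs.mul_right _) ?_ (.of_forall fun y hy => ?_)
  · simp only [intervalIntegral.integral_const_mul] at termwise
    exact HasSum.congr_fun termwise fun k => by ring
  · rw [Set.uIoc_of_le zero_le_one] at hy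
    rw [norm_mul, norm_mul (y ^ _), Real.norm_of_nonneg (pow_nonneg hy.1.le _), Real.norm_eq_abs,
      Real.norm_eq_abs]
    gcongr
    exact mul_le_of_le_one_left (abs_nonneg _) (pow_le_one₀ hy.1.le hy.2)
  · simp only [tsum_mul_right]
    exact Continuous.intervalIntegrable (by fun_prop) _ _
  · rw [Set.uIoc_of_le zero_le_one] at hy
    refine HasSum.congr_fun ((hf (y.toNNReal * t)).mul_right (w y)) fun k => ?_
    rw [NNReal.coe_mul, Real.coe_toNNReal _ hy.1.le, mul_pow,
      show -(y ^ 2 * (t : ℝ) ^ 2 / 4) = y ^ 2 * -(t ^ 2 / 4) by ring, mul_pow, ← pow_mul]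
    ring

/-- The factors `m_i` such that `∏_{i < k} m_i` is the quotient of the `k`-th power series
coefficients of `t ↦ Ω_{2n-1}(2t)` and `Ω_n ^ 2`. -/
def sqMultiplier (n i : ℕ) : ℝ := 1 + (n - 1) / ((2 * i + n - 1) * (2 * i + 2 * n - 1))

/-- The density on `[0, 1]` whose moments are the `sqMultiplier n (k + N) - 1`. -/
def sqWeight (n N : ℕ) (y : ℝ) : ℝ :=
  (n - 1) / n * (y ^ (2 * N + n - 2) - y ^ (2 * N + 2 * n - 2))

section

variable {n : ℕ} (hn : 2 ≤ n)
include hn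

lemma sqWeight_nonneg (N : ℕ) {y : ℝ} (hy : y ∈ Set.Icc 0 1) : 0 ≤ sqWeight n N y := by
  have : (2 : ℝ) ≤ n := by exact_mod_cast hn
  exact mul_nonneg (div_nonneg (by linarith) (by linarith))
    (sub_nonneg.2 (pow_le_pow_of_le_one hy.1 hy.2 (by lia)))

lemma integral_pow_mul_sqWeight (N k : ℕ) :
    ∫ y in (0 : ℝ)..1, y ^ (2 * k) * sqWeight n N y = sqMultiplier n (k + N) - 1 := by
  have hn' : (2 : ℝ) ≤ n := by exact_mod_cast hn
  have split (y : ℝ) : y ^ (2 * k) * sqWeight n N y =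
      (n - 1) / n * (y ^ (2 * (k + N) + n - 2) - y ^ (2 * (k + N) + 2 * n - 2)) := by
    rw [sqWeight, mul_left_comm, mul_sub, ← pow_add, ← pow_add]
    congr 4 <;> lia
  have exponent (p : ℕ) (hp : 2 ≤ p) : ((2 * (k + N) + p - 2 : ℕ) + 1 : ℝ) =
      2 * (k + N) + p - 1 := by
    rw [Nat.cast_sub (by lia)]
    push_cast
    ring
  have h₁ : (2 * (k + N) + n - 1 : ℝ) ≠ 0 := by linarith
  have h₂ : (2 * (k + N + n) - 1 : ℝ) ≠ 0 := by linarith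
  simp only [split, intervalIntegral.integral_const_mul]
  rw [intervalIntegral.integral_sub (by simp) (by simp), integral_pow, integral_pow,
    exponent n hn, exponent (2 * n) (by lia), sqMultiplier]
  push_cast
  simp only [one_pow, zero_pow (Nat.succ_ne_zero _), sub_zero, add_sub_cancel_left]
  field_simp
  ring

lemma one_le_sqMultiplier (i : ℕ) : 1 ≤ sqMultiplier n i := by
  have hn' : (2 : ℝ) ≤ n := by exact_mod_cast hn
  exact le_add_of_nonneg_right
    (div_nonneg (by linarith) (mul_nonneg (by linarith) (by linarith)))

lemma multipliable_sqMultiplier : Multipliable (sqMultiplier n) := by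
  have hn' : (2 : ℝ) ≤ n := by exact_mod_cast hn
  refine Real.multipliable_one_add_of_summable ?_
  have summable : Summable fun i : ℕ => (n - 1 : ℝ) * (1 / ((i + 1 : ℕ) : ℝ) ^ 2) :=
    ((summable_nat_add_iff 1).2 (Real.summable_one_div_nat_pow.2 one_lt_two)).mul_left _
  refine summable.of_nonneg_of_le (fun i => ?_) fun i => ?_
  · simpa only [sqMultiplier, le_add_iff_nonneg_right] using one_le_sqMultiplier hn i
  rw [mul_one_div, sq]
  push_cast
  gcongr <;> linarith

lemma prod_sqMultiplier_le_tprod (j : ℕ) :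
    ∏ i ∈ range j, sqMultiplier n i ≤ ∏' i, sqMultiplier n i := by
  refine Monotone.ge_of_tendsto (monotone_nat_of_le_succ fun j => ?_)
    (multipliable_sqMultiplier hn).hasProd.tendsto_prod_nat j
  rw [prod_range_succ]
  exact le_mul_of_one_le_right
    (prod_nonneg fun i _ => zero_le_one.trans (one_le_sqMultiplier hn i)) (one_le_sqMultiplier hn j)

lemma prod_sqMultiplier_mul_besselSqCoeff (k : ℕ) :
    (∏ i ∈ range k, sqMultiplier n i) * besselSqCoeff (n / 2) k =
      4 ^ k * besselCoeff ((2 * n - 1 : ℕ) / 2) k := by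
  have hn' : (2 : ℝ) ≤ n := by exact_mod_cast hn
  have dim : ((2 * n - 1 : ℕ) : ℝ) = 2 * n - 1 := by
    rw [Nat.cast_sub (by lia)]
    push_cast
    rfl
  rw [dim]
  induction k with
  | zero => simp [besselCoeff, besselSqCoeff]
  | succ k ih =>
    have : (0 : ℝ) ≤ k := by positivity
    have h₁ : (0 : ℝ) < 2 * k + n - 1 := by linarith
    have h₂ : (0 : ℝ) < 2 * k + 2 * n - 1 := by linarith
    have multiplier : sqMultiplier n k * ((2 * k + n - 1) * (2 * k + 2 * n - 1)) =
        2 * (2 * k + n) * (k + n - 1) := by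
      rw [sqMultiplier, add_mul, div_mul_cancel₀ _ (mul_pos h₁ h₂).ne']
      ring
    have coeff := besselCoeff_succ (ν := (2 * n - 1) / 2) (by linarith) k
    have sqCoeff := besselSqCoeff_succ (ν := n / 2) (by linarith) k
    have hk₁ : (k + 1 : ℝ) ≠ 0 := by positivity
    refine mul_left_cancel₀ (mul_ne_zero hk₁ (mul_pos h₁ h₂).ne') ?_
    rw [prod_range_succ, pow_succ]
    generalize ∏ i ∈ range k, sqMultiplier n i = P at *
    linear_combination (k + 1) * P * besselSqCoeff (n / 2) (k + 1) * multiplier +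
      4 * P * sqCoeff + 8 * (2 * k + n - 1) * ih - 8 * (2 * k + n - 1) * 4 ^ k * coeff

lemma exists_isRadialPosDef_prod_sqMultiplier (N : ℕ) :
    ∃ f, IsRadialPosDef (2 * n - 1) f ∧ ∀ t : ℝ≥0, HasSum (fun k =>
      (∏ i ∈ range (k + N), sqMultiplier n i) * besselSqCoeff (n / 2) k *
        (-(t ^ 2 / 4 : ℝ)) ^ k) (f t) := by
  induction N with
  | zero =>
    refine ⟨_, (isRadialPosDef_schoenbergKernel (by lia)).comp_mul 2, fun t => ?_⟩
    have series := (hasGaussianSeries_schoenbergKernel (by lia : 1 ≤ 2 * n - 1)).hasSum (2 * t)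
    refine HasSum.congr_fun series fun k => ?_
    rw [add_zero, prod_sqMultiplier_mul_besselSqCoeff hn, NNReal.coe_mul, mul_pow,
      NNReal.coe_ofNat, show -(2 ^ 2 * (t : ℝ) ^ 2 / 4) = 4 * -(t ^ 2 / 4) by ring, mul_pow]
    ring
  | succ N ih =>
    obtain ⟨f, hf, series⟩ := ih
    have hw : Continuous (sqWeight n N) := by unfold sqWeight; fun_prop
    refine ⟨_, hf.add (hf.integral_comp_mul hw fun y hy => sqWeight_nonneg hn N hy), fun t => ?_⟩
    refine HasSum.congr_fun ((series t).add (hasSum_integral_comp_mul series hw t)) fun k => ?_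
    rw [integral_pow_mul_sqWeight hn, ← add_assoc k, prod_range_succ]
    ring

end

lemma isRadialPosDef_schoenbergKernel_sq {n : ℕ} (hn : 1 ≤ n) :
    IsRadialPosDef (2 * n - 1) fun t => schoenbergKernel n t ^ 2 := by
  obtain rfl | hn₂ := hn.eq_or_lt
  · simpa [sq] using isRadialPosDef_schoenbergKernel_mul le_rfl zero_le_one zero_le_one
  have continuous_sq : Continuous fun t : ℝ≥0 => schoenbergKernel n t ^ 2 :=
    (isRadialPosDef_schoenbergKernel hn).1.pow 2
  choose f hf series using exists_isRadialPosDef_prod_sqMultiplier hn₂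
  set P := ∏' i, sqMultiplier n i
  have P_pos : 0 < P := by
    simpa using zero_lt_one.trans_le (prod_sqMultiplier_le_tprod hn₂ 0)
  refine isRadialPosDef_of_tendsto continuous_sq
    (fun N => (hf N).const_mul (inv_nonneg.2 P_pos.le)) fun t => ?_
  have square := (hasGaussianSeries_schoenbergKernel_sq hn).hasSum t
  have limit : Tendsto (f · t) atTop (𝓝 (P * schoenbergKernel n t ^ 2)) := by
    simp only [← (series _ t).tsum_eq, ← square.tsum_eq, ← tsum_mul_left, mul_assoc]
    refine tendsto_tsum_of_dominated_convergence (square.summable.abs.mul_left P) (fun k => ?_)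
      (.of_forall fun N k => ?_)
    · have shift := tendsto_add_atTop_nat k
      simp only [add_comm _ k] at shift
      exact ((multipliable_sqMultiplier hn₂).hasProd.tendsto_prod_nat.comp shift).mul_const _
    · have prod_nonneg : 0 ≤ ∏ i ∈ range (k + N), sqMultiplier n i :=
        prod_nonneg fun i _ => zero_le_one.trans (one_le_sqMultiplier hn₂ i)
      rw [norm_mul, Real.norm_of_nonneg prod_nonneg, Real.norm_eq_abs]
      gcongr
      exact prod_sqMultiplier_le_tprod hn₂ _
  simpa [P_pos.ne'] using limit.const_mul P⁻¹

theorem theorem1p2 (n : ℕ) (hn : 1 ≤ n) :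
    (∀ a b : ℝ, 0 ≤ a → 0 ≤ b → a ≠ b →
      (fun t : ℝ≥0 => schoenbergKernel n (a * t) * schoenbergKernel n (b * t)) ∈
        radialPosDefClass n \ radialPosDefClass (n + 1)) ∧
    (fun t : ℝ≥0 => schoenbergKernel n t ^ 2) ∈
      radialPosDefClass (2 * n - 1) \ radialPosDefClass (2 * n) :=
  ⟨fun _ _ ha hb hab => ⟨isRadialPosDef_schoenbergKernel_mul hn ha hb,
    not_isRadialPosDef_succ_schoenbergKernel_mul hn ha hb hab⟩,
    isRadialPosDef_schoenbergKernel_sq hn, not_isRadialPosDef_schoenbergKernel_sq hn⟩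

end
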